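/- Let $E$ be a (Grothendieck) topos, i.e. the category of sheaves of sets on a small site. Let $A$ be a commutative ring in $E$, let $S$ be an object of $E$, and let $A[S]$ be the free commutative $A$-algebra on $S$ (the sheaf associated with $U \mapsto A(U)[S(U)]$). Let $J$ be an injective object of the category of $A[S]$-modules in $E$. Let $A\text{-alg}/A[S]$ be the category of commutative $A$-algebras $X$ in $E$ equipped with an $A$-algebra map $X \to A[S]$, and let $\underline{\mathrm{Der}}_A(-, J)$ be the presheaf of abelian groups on it sending $X$ to the group $\mathrm{Der}_A(X, J)$ of $A$-derivations $X \to J$, where $J$ is an $X$-module through $X \to A[S]$. Give $A\text{-alg}/A[S]$ the topology in which a family $\{X_i \to X\}$ is covering if every finite set $\Lambda$ of sections of $X$ over an object $U$ lifts, locally on $U$, to a single member of the family: there is a covering family $\{V_k \to U\}$ such that for each $k$ there is one index $i$ for which all of $\Lambda|_{V_k}$ lifts to $\Gamma(V_k, X_i)$. Then $\underline{\mathrm{Der}}_A(-, J)$ is a sheaf, and its higher cohomology vanishes: $$H^p\bigl(A\text{-alg}/A[S],\ \underline{\mathrm{Der}}_A(-, J)\bigr) = 0 \qquad \text{for all } p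 \neq 0 .$$ The same holds for the coarser topology in which the index is required to be uniform on $U$: a family $\{X_i \to X\}$ is covering if for every object $U$ of $E$ and every finite set $\Lambda \subseteq \Gamma(U, X)$ there are one index $i$ and an epimorphism $V \to U$ in $E$ such that all of $\Lambda|_V$ lifts to $\Gamma(V, X_i)$. (The site $A\text{-alg}/A[S]$ is large; cohomology is that of abelian sheaves in the next universe.) -/

import Mathlib

open CategoryTheory Opposite Limits

universe u

namespace TopAlg

section LargeSite

variable {D : Type (u + 1)} [Category.{u} D]

/-- Abelian sheaves (in the next universe) on a large, locally small site form a Grothendieck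
abelian category, so that sheaf cohomology on such a site is available. -/
instance isGrothendieckAbelian_sheaf (τ : GrothendieckTopology D) :
    IsGrothendieckAbelian.{u + 1} (Sheaf τ AddCommGrpCat.{u + 1}) := by
  have : EssentiallySmall.{u + 1} D := essentiallySmallSelf.{u + 1, u, u + 1} D
  exact Sheaf.isGrothendieckAbelian_of_essentiallySmall τ _

end LargeSite

/-! The topos `E` is the category `Sheaf K (Type u)` of sheaves of sets on a small site `(C, K)`.
A ring in `E` is a sheaf of commutative rings, an `A`-algebra is an object of `Under A`, and the
category of `A`-algebras over an `A`-algebra `B` is `Over B`. -/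

variable {C : Type u} [SmallCategory C] {K : GrothendieckTopology C}

section FreeAlgebra

variable (A : Sheaf K CommRingCat.{u}) (S : Sheaf K (Type u))

/-- The presheaf `U ↦ A(U)[S(U)]` of polynomial algebras. -/
noncomputable def polyPresheaf : Cᵒᵖ ⥤ CommRingCat.{u} where
  obj U := CommRingCat.of (MvPolynomial (S.obj.obj U) (A.obj.obj U))
  map f := CommRingCat.ofHom (MvPolynomial.eval₂Hom (MvPolynomial.C.comp (A.obj.map f).hom)
    (fun s => MvPolynomial.X (S.obj.map f s)))
  map_id U := by
    ext : 1
    apply MvPolynomial.ringHom_ext <;> intro x <;> simp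
  map_comp f g := by
    ext : 1
    apply MvPolynomial.ringHom_ext <;> intro x <;> simp

/-- The inclusion of the constants `A(U) → A(U)[S(U)]`. -/
noncomputable def polyConst : A.obj ⟶ polyPresheaf A S where
  app U := CommRingCat.ofHom MvPolynomial.C
  naturality U V f := by
    ext x
    simp [polyPresheaf]

/-- The free `A`-algebra `A[S]` on the sheaf of sets `S`: the sheaf associated with
`U ↦ A(U)[S(U)]`. -/
noncomputable def freeAlg : Under A :=
  Under.mk (Y := (presheafToSheaf K CommRingCat.{u}).obj (polyPresheaf A S))
    ⟨polyConst A S ≫ toSheafify K (polyPresheaf A S)⟩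

end FreeAlgebra

variable {A : Sheaf K CommRingCat.{u}} {B : Under A}

/-- The ring of sections over `U` of an `A`-algebra `X` over `B`. -/
abbrev Sec (X : Over B) (U : Cᵒᵖ) : CommRingCat.{u} := X.left.right.obj.obj U

/-- Restriction of sections of an `A`-algebra over `B`. -/
abbrev res (X : Over B) {U V : Cᵒᵖ} (g : U ⟶ V) : Sec X U →+* Sec X V :=
  (X.left.right.obj.map g).hom

/-- The map on sections induced by a morphism of `A`-algebras over `B`. -/
abbrev secMap {Y X : Over B} (f : Y ⟶ X) (U : Cᵒᵖ) : Sec Y U →+* Sec X U :=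
  (f.left.right.hom.app U).hom

/-- The sections of the structure map from `A` to an `A`-algebra over `B`. -/
abbrev structMap (X : Over B) (U : Cᵒᵖ) : A.obj.obj U →+* Sec X U :=
  (X.left.hom.hom.app U).hom

/-- The sections of the map from an `A`-algebra over `B` to `B`. -/
abbrev augMap (X : Over B) (U : Cᵒᵖ) : Sec X U →+* B.right.obj.obj U :=
  (X.hom.right.hom.app U).hom

/-- The underlying sheaf of sets of an `A`-algebra over `B`. -/
noncomputable def toSet (B : Under A) : Over B ⥤ Sheaf K (Type u) :=
  Over.forget B ⋙ Under.forget A ⋙ sheafCompose K (forget CommRingCat.{u})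

lemma secMap_res {Y X : Over B} (f : Y ⟶ X) {U V : Cᵒᵖ} (g : U ⟶ V) (y : Sec Y U) :
    secMap f V (res Y g y) = res X g (secMap f U y) :=
  congr($(f.left.right.hom.naturality g) y)

lemma secMap_comp {Z Y X : Over B} (f : Z ⟶ Y) (g : Y ⟶ X) (U : Cᵒᵖ) (z : Sec Z U) :
    secMap (f ≫ g) U z = secMap g U (secMap f U z) := rfl

lemma secMap_structMap {Y X : Over B} (f : Y ⟶ X) (U : Cᵒᵖ) (a : A.obj.obj U) :
    secMap f U (structMap Y U a) = structMap X U a :=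
  congr(($(Under.w f.left)).hom.app U a)

lemma augMap_secMap {Y X : Over B} (f : Y ⟶ X) (U : Cᵒᵖ) (y : Sec Y U) :
    augMap X U (secMap f U y) = augMap Y U y :=
  congr((($(Over.w f)).right).hom.app U y)

lemma res_comp (X : Over B) {U V W : Cᵒᵖ} (g : U ⟶ V) (h : V ⟶ W) (x : Sec X U) :
    res X (g ≫ h) x = res X h (res X g x) :=
  congr($(X.left.right.obj.map_comp g h) x)

instance : PreservesLimitsOfShape WalkingCospan (Under.forget A) :=
  preservesLimitOfShape_of_createsLimitsOfShape_and_hasLimitsOfShape _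

instance : PreservesLimitsOfShape WalkingCospan (toSet B) := by
  unfold toSet
  infer_instance

/-- Sections of a fibre product of algebras are pairs of sections. -/
lemma exists_sec_pullback {Y Z X : Over B} (f : Y ⟶ X) (g : Z ⟶ X) (U : Cᵒᵖ)
    (y : Sec Y U) (z : Sec Z U) (h : secMap f U y = secMap g U z) :
    ∃ w : Sec (pullback f g) U,
      secMap (pullback.fst f g) U w = y ∧ secMap (pullback.snd f g) U w = z := by
  have sq := ((IsPullback.of_hasPullback f g).map (toSet B)).map
    (sheafToPresheaf K (Type u) ⋙ (evaluation Cᵒᵖ (Type u)).obj U)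
  exact ((Types.isPullback_iff _ _ _ _).1 sq).2.2 y z h

/-! ### The topology -/

/-- The morphisms `V ⟶ U` after restriction along which all members of a finite set `Λ` of
sections of `X` over `U` lift to one and the same member of the sieve `R`. -/
def liftSieve {X : Over B} (R : Sieve X) {U : C} (Λ : Finset (Sec X (op U))) : Sieve U where
  arrows V g := ∃ (Y : Over B) (f : Y ⟶ X), R f ∧
    ∀ x ∈ Λ, ∃ y : Sec Y (op V), secMap f (op V) y = res X g.op x
  downward_closed := by
    rintro V W g ⟨Y, f, hf, h⟩ k
    refine ⟨Y, f, hf, fun x hx => ?_⟩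
    obtain ⟨y, hy⟩ := h x hx
    exact ⟨res Y k.op y, by rw [secMap_res, hy, op_comp, res_comp]⟩

/-- The topology on `A`-algebras over `B` in which a sieve on `X` is covering if every finite set
of sections of `X` over an object `U` can, locally on `U`, be lifted to a single member of the
sieve. -/
def liftTopology (B : Under A) : GrothendieckTopology (Over B) where
  sieves X := {R | ∀ (U : C) (Λ : Finset (Sec X (op U))), liftSieve R Λ ∈ K U}
  top_mem' X U Λ := by
    convert K.top_mem U
    ext V g
    simp only [Sieve.top_apply, iff_true]
    exact ⟨X, 𝟙 X, trivial, fun x _ => ⟨res X g.op x, rfl⟩⟩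
  pullback_stable' X Z R g hR U Λ := by
    classical
    refine K.superset_covering ?_ (hR U (Λ.image (secMap g (op U))))
    rintro V k ⟨Y, f, hf, h⟩
    refine ⟨pullback f g, pullback.snd f g, ?_, fun z hz => ?_⟩
    · change R (pullback.snd f g ≫ g)
      rw [← pullback.condition]
      exact R.downward_closed hf _
    · obtain ⟨y, hy⟩ := h _ (Finset.mem_image_of_mem _ hz)
      rw [← secMap_res] at hy
      obtain ⟨w, -, hw⟩ := exists_sec_pullback f g (op V) y _ hy
      exact ⟨w, hw⟩
  transitive' X R hR R' h U Λ := by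
    classical
    refine K.transitive (hR U Λ) _ ?_
    rintro V g ⟨Y, f, hf, hY⟩
    choose! y hy using hY
    refine K.superset_covering ?_ (h hf V (Λ.image y))
    rintro W k ⟨Z, e, he, hZ⟩
    refine ⟨Z, e ≫ f, he, fun x hx => ?_⟩
    obtain ⟨z, hz⟩ := hZ _ (Finset.mem_image_of_mem _ hx)
    exact ⟨z, by rw [secMap_comp, hz, secMap_res, hy x hx, op_comp, res_comp]⟩

/-- The topology on `A`-algebras over `B` in which a sieve on `X` is covering if for every finite
set `Λ` of sections of `X` over an object `U` of the topos there is a single member of the sieve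
to which all of `Λ` lifts after pulling back along an epimorphism `V ⟶ U`. -/
def uniformLiftTopology (B : Under A) : GrothendieckTopology (Over B) where
  sieves X := {R | ∀ (U : Sheaf K (Type u)) (Λ : Finset (U ⟶ (toSet B).obj X)),
    ∃ (Y : Over B) (f : Y ⟶ X), R f ∧ ∃ (V : Sheaf K (Type u)) (e : V ⟶ U), Epi e ∧
      ∀ x ∈ Λ, ∃ y : V ⟶ (toSet B).obj Y, y ≫ (toSet B).map f = e ≫ x}
  top_mem' X U Λ := ⟨X, 𝟙 X, trivial, U, 𝟙 U, inferInstance, fun x _ => ⟨x, by simp⟩⟩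
  pullback_stable' X Z R g hR U Λ := by
    classical
    obtain ⟨Y, f, hf, V, e, he, h⟩ := hR U (Λ.image (fun x => x ≫ (toSet B).map g))
    refine ⟨pullback f g, pullback.snd f g, ?_, V, e, he, fun z hz => ?_⟩
    · change R (pullback.snd f g ≫ g)
      rw [← pullback.condition]
      exact R.downward_closed hf _
    · obtain ⟨y, hy⟩ := h _ (Finset.mem_image_of_mem _ hz)
      have sq := (IsPullback.of_hasPullback f g).map (toSet B)
      exact ⟨sq.lift y (e ≫ z) (by simpa using hy), sq.lift_snd _ _ _⟩
  transitive' X R hR R' h U Λ := by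
    classical
    obtain ⟨Y, f, hf, V, e, he, hY⟩ := hR U Λ
    choose y hy using hY
    let y' : {x // x ∈ Λ} → (V ⟶ (toSet B).obj Y) := fun x => y x.1 x.2
    obtain ⟨Z, d, hd, W, k, hk, hZ⟩ := h hf V (Λ.attach.image y')
    refine ⟨Z, d ≫ f, hd, W, k ≫ e, epi_comp _ _, fun x hx => ?_⟩
    obtain ⟨z, hz⟩ := hZ _ (Finset.mem_image_of_mem _ (Finset.mem_attach _ ⟨x, hx⟩))
    have hz' : z ≫ (toSet B).map d = k ≫ y x hx := hz
    exact ⟨z, by rw [Functor.map_comp, reassoc_of% hz', hy x hx, Category.assoc]⟩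

lemma uniformLiftTopology_le : uniformLiftTopology B ≤ liftTopology B := by
  intro X R hR U Λ
  obtain ⟨Y, f, hf, V, e, he, h⟩ := hR ((toSet B).obj X) {𝟙 _}
  obtain ⟨y, hy⟩ := h _ (Finset.mem_singleton_self _)
  have hepi : Epi ((toSet B).map f) := by
    have : Epi (y ≫ (toSet B).map f) := by rw [hy, Category.comp_id]; exact he
    exact epi_of_epi y _
  have hs : Sheaf.IsLocallySurjective ((toSet B).map f) :=
    (Sheaf.isLocallySurjective_iff_epi _).2 hepi
  have key : ∀ Λ : Finset (Sec X (op U)), ∃ T ∈ K U, ∀ ⦃V : C⦄ (g : V ⟶ U), T g →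
      ∀ x ∈ Λ, ∃ y : Sec Y (op V), secMap f (op V) y = res X g.op x := by
    classical
    intro Λ
    induction Λ using Finset.induction_on with
    | empty => exact ⟨⊤, K.top_mem U, by simp⟩
    | insert a s _ ih =>
      obtain ⟨T, hT, hT'⟩ := ih
      refine ⟨T ⊓ Presheaf.imageSieve ((toSet B).map f).hom a,
        K.intersection_covering hT (hs.imageSieve_mem a), ?_⟩
      rintro V g ⟨hg, ha⟩ x hx
      rcases Finset.mem_insert.1 hx with rfl | hx
      · exact ha
      · exact hT' g hg x hx
  obtain ⟨T, hT, hT'⟩ := key Λ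
  exact K.superset_covering (fun V g hg => ⟨Y, f, hf, hT' g hg⟩) hT

/-! ### Derivations -/

/-- The sheaf of rings underlying an `A`-algebra. -/
abbrev ringOf (B : Under A) : Sheaf K RingCat.{u} :=
  (sheafCompose K (forget₂ CommRingCat.{u} RingCat.{u})).obj B.right

variable (J : SheafOfModules.{u} (ringOf B))

/-- A `B`-module `J`, regarded as an `X`-module for an `A`-algebra `X` over `B`. -/
noncomputable abbrev resMod (X : Over B) :
    PresheafOfModules.{u} (X.left.right.obj ⋙ forget₂ CommRingCat.{u} RingCat.{u}) :=
  (PresheafOfModules.restrictScalars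
    (Functor.whiskerRight X.hom.right.hom (forget₂ CommRingCat.{u} RingCat.{u}))).obj J.val

/-- The `A`-derivations from an `A`-algebra `X` over `B` to the `B`-module `J`. -/
abbrev Der (X : Over B) : Type u := (resMod J X).Derivation' X.left.hom.hom

namespace Der

variable {J} {X Y Z : Over B}

/-- The group of sections of `J` over `U`. -/
abbrev Mod (J : SheafOfModules.{u} (ringOf B)) (U : Cᵒᵖ) : Type u := J.val.obj U

instance (U : Cᵒᵖ) : Module (B.right.obj.obj U) (Mod J U) := (J.val.obj U).isModule

/-- Restriction of sections of `J`. -/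
noncomputable def mres (J : SheafOfModules.{u} (ringOf B)) {U V : Cᵒᵖ} (g : U ⟶ V) : Mod J U →+ Mod J V :=
  (J.val.map g).hom.toAddMonoidHom

lemma mres_smul {U V : Cᵒᵖ} (g : U ⟶ V) (r : B.right.obj.obj U) (m : Mod J U) :
    mres J g (r • m) = (B.right.obj.map g r : B.right.obj.obj V) • mres J g m :=
  J.val.map_smul g r m

/-- A derivation as a family of additive maps `X(U) → J(U)`. -/
def ev (d : Der J X) (U : Cᵒᵖ) : Sec X U →+ Mod J U := d.d (X := U)

@[ext]
lemma ext' {d d' : Der J X} (h : ∀ U x, ev d U x = ev d' U x) : d = d' := by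
  apply PresheafOfModules.Derivation.ext
  funext U
  exact AddMonoidHom.ext (h U)

lemma ev_mul (d : Der J X) (U : Cᵒᵖ) (a b : Sec X U) :
    ev d U (a * b) = augMap X U a • ev d U b + augMap X U b • ev d U a :=
  d.d_mul a b

lemma ev_map (d : Der J X) {U V : Cᵒᵖ} (g : U ⟶ V) (x : Sec X U) :
    ev d V (res X g x) = mres J g (ev d U x) :=
  d.d_map g x

lemma ev_structMap (d : Der J X) (U : Cᵒᵖ) (a : A.obj.obj U) :
    ev d U (structMap X U a) = 0 :=
  PresheafOfModules.Derivation.d_app d a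

/-- A family of additive maps `X(U) → J(U)` that is compatible with restriction, satisfies the
Leibniz rule and vanishes on the image of `A` is a derivation. -/
def mk' (d : ∀ U : Cᵒᵖ, Sec X U →+ Mod J U)
    (d_mul : ∀ U a b, d U (a * b) = augMap X U a • d U b + augMap X U b • d U a)
    (d_map : ∀ {U V : Cᵒᵖ} (g : U ⟶ V) (x : Sec X U), d V (res X g x) = mres J g (d U x))
    (d_struct : ∀ U a, d U (structMap X U a) = 0) : Der J X where
  d {U} := d U
  d_mul {U} a b := d_mul U a b
  d_map g x := d_map g x
  d_app {U} a := d_struct U a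

@[simp]
lemma ev_mk' (d : ∀ U : Cᵒᵖ, Sec X U →+ Mod J U) (h₁ h₂ h₃) (U : Cᵒᵖ) (x : Sec X U) :
    ev (mk' d h₁ h₂ h₃) U x = d U x := rfl

instance : Zero (Der J X) where
  zero := mk' (fun _ => 0) (by intros; simp) (fun g x => (map_zero (mres J g)).symm)
    (by intros; simp)

instance : Add (Der J X) where
  add d e := mk' (fun U => ev d U + ev e U)
    (by intro U a b; simp only [AddMonoidHom.add_apply, ev_mul, smul_add]; abel)
    (fun g x => by simp only [AddMonoidHom.add_apply, ev_map, map_add])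
    (by intro U a; simp only [AddMonoidHom.add_apply, ev_structMap, add_zero])

instance : Neg (Der J X) where
  neg d := mk' (fun U => -ev d U)
    (by intro U a b; simp only [AddMonoidHom.neg_apply, ev_mul, smul_neg]; abel)
    (fun g x => by simp only [AddMonoidHom.neg_apply, ev_map, map_neg])
    (by intro U a; simp only [AddMonoidHom.neg_apply, ev_structMap, neg_zero])

@[simp] lemma ev_zero (U : Cᵒᵖ) (x : Sec X U) : ev (0 : Der J X) U x = 0 := rfl

@[simp] lemma ev_add (d e : Der J X) (U : Cᵒᵖ) (x : Sec X U) :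
    ev (d + e) U x = ev d U x + ev e U x := rfl

@[simp] lemma ev_neg (d : Der J X) (U : Cᵒᵖ) (x : Sec X U) : ev (-d) U x = -ev d U x := rfl

/-- Derivations form an abelian group under pointwise addition. -/
instance : AddCommGroup (Der J X) where
  add_assoc d e f := by ext U x; simp [add_assoc]
  zero_add d := by ext U x; simp
  add_zero d := by ext U x; simp
  add_comm d e := by ext U x; simp [add_comm]
  neg_add_cancel d := by ext U x; simp
  nsmul := nsmulRec
  zsmul := zsmulRec

/-- Composition of a derivation with a morphism of `A`-algebras over `B`. -/
def precomp (f : Y ⟶ X) : Der J X →+ Der J Y where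
  toFun d := mk' (fun U => (ev d U).comp (secMap f U).toAddMonoidHom)
    (by
      intro U a b
      change ev d U (secMap f U (a * b)) =
        augMap Y U a • ev d U (secMap f U b) + augMap Y U b • ev d U (secMap f U a)
      rw [map_mul, ev_mul, augMap_secMap, augMap_secMap])
    (fun {U V} g x => by
      change ev d V (secMap f V (res Y g x)) = mres J g (ev d U (secMap f U x))
      rw [secMap_res, ev_map])
    (by
      intro U a
      change ev d U (secMap f U (structMap Y U a)) = 0
      rw [secMap_structMap, ev_structMap])
  map_zero' := rfl
  map_add' _ _ := rfl

@[simp]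
lemma ev_precomp (f : Y ⟶ X) (d : Der J X) (U : Cᵒᵖ) (y : Sec Y U) :
    ev (precomp f d) U y = ev d U (secMap f U y) := rfl

end Der

/-- The presheaf `X ↦ Der_A(X, J)` of abelian groups on the category of `A`-algebras over `B`
(with values in the next universe, because that category is large). -/
def derPresheaf : (Over B)ᵒᵖ ⥤ AddCommGrpCat.{u + 1} where
  obj X := AddCommGrpCat.of (ULift.{u + 1} (Der J X.unop))
  map f := AddCommGrpCat.ofHom (AddEquiv.ulift.symm.toAddMonoidHom.comp
    ((Der.precomp f.unop).comp AddEquiv.ulift.toAddMonoidHom))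
  map_id _ := rfl
  map_comp _ _ := rfl

/-! ### Derivations form a sheaf -/

namespace Der

variable {J}

lemma isSheaf_mod : Presieve.IsSheaf K (J.val.presheaf ⋙ forget AddCommGrpCat.{u}) :=
  (isSheaf_iff_isSheaf_of_type _ _).1
    ((Presheaf.isSheaf_iff_isSheaf_forget K _ (forget AddCommGrpCat.{u})).1 J.isSheaf)

lemma mod_ext {U : C} {T : Sieve U} (hT : T ∈ K U) {m n : Mod J (op U)}
    (h : ∀ ⦃V : C⦄ (g : V ⟶ U), T g → mres J g.op m = mres J g.op n) : m = n :=
  (isSheaf_mod (J := J) T hT).isSeparatedFor.ext h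

lemma mod_glue {U : C} {T : Sieve U} (hT : T ∈ K U)
    (x : ∀ ⦃V : C⦄ (g : V ⟶ U), T g → Mod J (op V))
    (hx : ∀ ⦃V W : C⦄ (g : V ⟶ U) (hg : T g) (k : W ⟶ V),
      mres J k.op (x g hg) = x (k ≫ g) (T.downward_closed hg k)) :
    ∃ m : Mod J (op U), ∀ ⦃V : C⦄ (g : V ⟶ U) (hg : T g), mres J g.op m = x g hg := by
  have hc : Presieve.FamilyOfElements.Compatible
      (P := J.val.presheaf ⋙ forget AddCommGrpCat.{u}) (R := T.arrows) x := by
    refine (Presieve.compatible_iff_sieveCompatible _).2 ?_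
    intro V W g k hg
    exact (hx g hg k).symm
  exact ⟨_, fun V g hg => (isSheaf_mod (J := J) T hT).valid_glue hc g hg⟩

lemma mres_comp {U V W : Cᵒᵖ} (g : U ⟶ V) (h : V ⟶ W) (m : Mod J U) :
    mres J (g ≫ h) m = mres J h (mres J g m) :=
  J.val.map_comp_apply g h m

lemma mres_id {U : Cᵒᵖ} (m : Mod J U) : mres J (𝟙 U) m = m :=
  congr($(J.val.presheaf.map_id U) m)

section Glue

variable {X : Over B} {R : Sieve X}
  (x : ∀ ⦃Y : Over B⦄ (f : Y ⟶ X), R f → Der J Y)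

/-- The element `m` of `J(U)` is the value at `a` of the derivation to be glued from the
family `x`. -/
def IsValue {U : C} (a : Sec X (op U)) (m : Mod J (op U)) : Prop :=
  ∀ ⦃V : C⦄ (g : V ⟶ U) ⦃Y : Over B⦄ (f : Y ⟶ X) (hf : R f) (y : Sec Y (op V)),
    secMap f (op V) y = res X g.op a → mres J g.op m = ev (x f hf) (op V) y

variable {x}

lemma isValue_res {U V : C} (g : V ⟶ U) {a : Sec X (op U)} {m : Mod J (op U)}
    (h : IsValue x a m) : IsValue x (res X g.op a) (mres J g.op m) := by
  intro W k Y f hf y hy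
  rw [← mres_comp, ← op_comp]
  exact h (k ≫ g) f hf y (by rw [hy, op_comp, res_comp])

lemma isValue_of_cover {U : C} {T : Sieve U} (hT : T ∈ K U) {a : Sec X (op U)}
    {m : Mod J (op U)}
    (hx : ∀ ⦃Y Z : Over B⦄ (f : Y ⟶ X) (hf : R f) (k : Z ⟶ Y),
      precomp k (x f hf) = x (k ≫ f) (R.downward_closed hf k))
    (h : ∀ ⦃V : C⦄ (g : V ⟶ U), T g → ∃ (Y : Over B) (f : Y ⟶ X) (hf : R f)
      (y : Sec Y (op V)), secMap f (op V) y = res X g.op a ∧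
        mres J g.op m = ev (x f hf) (op V) y) : IsValue x a m := by
  intro W k Z e he z hz
  refine mod_ext (K.pullback_stable k hT) fun V g hg => ?_
  obtain ⟨Y, f, hf, y, hy, hm⟩ := h (g ≫ k) hg
  rw [← mres_comp, ← op_comp, hm, ← ev_map]
  have hyz : secMap f (op V) y = secMap e (op V) (res Z g.op z) := by
    rw [hy, secMap_res, hz, op_comp, res_comp]
  obtain ⟨w, hw₁, hw₂⟩ := exists_sec_pullback f e (op V) y _ hyz
  rw [← hw₁, ← hw₂, ← ev_precomp, ← ev_precomp, hx, hx]
  congr 2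
  exact congr(x $(pullback.condition) _)

lemma exists_isValue (hR : R ∈ liftTopology B X)
    (hx : ∀ ⦃Y Z : Over B⦄ (f : Y ⟶ X) (hf : R f) (k : Z ⟶ Y),
      precomp k (x f hf) = x (k ≫ f) (R.downward_closed hf k))
    {U : C} (a : Sec X (op U)) : ∃ m : Mod J (op U), IsValue x a m := by
  have hT := hR U {a}
  have hl : ∀ ⦃V : C⦄ (g : V ⟶ U), liftSieve R {a} g → ∃ (Y : Over B) (f : Y ⟶ X) (_ : R f)
      (y : Sec Y (op V)), secMap f (op V) y = res X g.op a := by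
    rintro V g ⟨Y, f, hf, h⟩
    obtain ⟨y, hy⟩ := h a (Finset.mem_singleton_self a)
    exact ⟨Y, f, hf, y, hy⟩
  choose Y f hf y hy using hl
  have hval : ∀ ⦃V : C⦄ (g : V ⟶ U) (hg : liftSieve R {a} g),
      IsValue x (res X g.op a) (ev (x (f g hg) (hf g hg)) (op V) (y g hg)) := by
    intro V g hg
    refine isValue_of_cover (K.top_mem V) hx fun W k _ =>
      ⟨_, f g hg, hf g hg, res _ k.op (y g hg), ?_, ?_⟩
    · rw [secMap_res, hy]
    · rw [ev_map]
  obtain ⟨m, hm⟩ := mod_glue (J := J) hT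
    (fun V g hg => ev (x (f g hg) (hf g hg)) (op V) (y g hg)) (by
      intro V W g hg k
      exact hval g hg k _ (hf _ _) _ (by rw [hy, op_comp, res_comp]))
  refine ⟨m, isValue_of_cover hT hx fun V g hg => ⟨_, f g hg, hf g hg, y g hg, hy g hg, hm g hg⟩⟩

lemma isValue_unique (hR : R ∈ liftTopology B X) {U : C} {a : Sec X (op U)} {m n : Mod J (op U)}
    (hm : IsValue x a m) (hn : IsValue x a n) : m = n := by
  refine mod_ext (hR U {a}) ?_
  rintro V g ⟨Y, f, hf, h⟩
  obtain ⟨y, hy⟩ := h a (Finset.mem_singleton_self a)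
  rw [hm g f hf y hy, hn g f hf y hy]

lemma exists_glue (hR : R ∈ liftTopology B X)
    (hx : ∀ ⦃Y Z : Over B⦄ (f : Y ⟶ X) (hf : R f) (k : Z ⟶ Y),
      precomp k (x f hf) = x (k ≫ f) (R.downward_closed hf k)) :
    ∃ d : Der J X, ∀ ⦃Y : Over B⦄ (f : Y ⟶ X) (hf : R f), precomp f d = x f hf := by
  classical
  choose val hval using fun (U : C) (a : Sec X (op U)) => exists_isValue hR hx a
  have hadd : ∀ (U : C) (a b : Sec X (op U)), val U (a + b) = val U a + val U b := by
    intro U a b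
    refine isValue_unique hR (hval U _) (isValue_of_cover (hR U {a, b}) hx ?_)
    rintro V g ⟨Y, f, hf, h⟩
    obtain ⟨y, hy⟩ := h a (by simp)
    obtain ⟨z, hz⟩ := h b (by simp)
    exact ⟨Y, f, hf, y + z, by rw [map_add, map_add, hy, hz],
      by rw [map_add, map_add, hval U a g f hf y hy, hval U b g f hf z hz]⟩
  refine ⟨mk' (fun U => AddMonoidHom.mk' (val U.unop) (hadd U.unop)) ?_ ?_ ?_, ?_⟩
  · intro U a b
    refine isValue_unique hR (hval U.unop _) (isValue_of_cover (hR U.unop {a, b}) hx ?_)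
    rintro V g ⟨Y, f, hf, h⟩
    obtain ⟨y, hy⟩ := h a (by simp)
    obtain ⟨z, hz⟩ := h b (by simp)
    have haug : ∀ {y : Sec Y (op V)} {a : Sec X U}, secMap f (op V) y = res X g.op a →
        B.right.obj.map g.op (augMap X U a) = augMap Y (op V) y := by
      intro y a hy
      rw [← augMap_secMap f, hy]
      exact congr($(X.hom.right.hom.naturality g.op) a).symm
    refine ⟨Y, f, hf, y * z, by rw [map_mul, map_mul, hy, hz], ?_⟩
    rw [map_add, mres_smul, mres_smul, ev_mul, haug hy, haug hz]
    congr 2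
    · exact hval U.unop b g f hf z hz
    · exact hval U.unop a g f hf y hy
  · intro U V g a
    exact isValue_unique hR (hval V.unop _) (isValue_res g.unop (hval U.unop a))
  · intro U a
    refine isValue_unique hR (hval U.unop _) (isValue_of_cover (hR U.unop ∅) hx ?_)
    rintro V g ⟨Y, f, hf, -⟩
    refine ⟨Y, f, hf, structMap Y (op V) (A.obj.map g.op a), ?_, ?_⟩
    · rw [secMap_structMap]
      exact congr($(X.left.hom.hom.naturality g.op) a)
    · rw [map_zero, ev_structMap]
  · intro Y f hf
    ext U y
    have := hval U.unop (secMap f U y) (𝟙 _) f hf y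
      (congr($(X.left.right.obj.map_id U) (secMap f U y))).symm
    rw [op_id, mres_id] at this
    exact this

end Glue

lemma ext_of_cover {X : Over B} {R : Sieve X} (hR : R ∈ liftTopology B X) {d e : Der J X}
    (h : ∀ ⦃Y : Over B⦄ (f : Y ⟶ X), R f → precomp f d = precomp f e) : d = e := by
  ext U a
  refine mod_ext (hR U.unop {a}) ?_
  rintro V g ⟨Y, f, hf, hy⟩
  obtain ⟨y, hy⟩ := hy a (Finset.mem_singleton_self a)
  have hd : ∀ d : Der J X, mres J g.op (ev d U a) = ev (precomp f d) (op V) y := by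
    intro d
    rw [ev_precomp, hy, ev_map]
  exact (hd d).trans ((congr(ev $(h f hf) (op V) y)).trans (hd e).symm)

end Der

lemma derPresheaf_isSheaf : Presheaf.IsSheaf (liftTopology B) (derPresheaf J) := by
  rw [Presheaf.isSheaf_iff_isSheaf_forget.{u, u + 1, _} _ _ (forget AddCommGrpCat.{u + 1}),
    isSheaf_iff_isSheaf_of_type]
  intro X R hR
  refine Presieve.isSeparatedFor_and_exists_isAmalgamation_iff_isSheafFor.1 ⟨?_, ?_⟩
  · intro x d e hd he
    refine ULift.ext _ _ (Der.ext_of_cover hR fun Y f hf => ?_)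
    exact congrArg ULift.down ((hd f hf).trans (he f hf).symm)
  · intro x hx
    obtain ⟨d, hd⟩ := Der.exists_glue (J := J) (x := fun Y f hf => (x f hf).down) hR
      (fun Y Z f hf k => (congrArg ULift.down
        (((Presieve.compatible_iff_sieveCompatible _).1 hx) f k hf)).symm)
    exact ⟨ULift.up d, fun Y f hf => ULift.ext _ _ (hd f hf)⟩

/-- The sheaf `X ↦ Der_A(X, J)` of `A`-derivations with values in `J`. -/
def derSheaf : Sheaf (liftTopology B) AddCommGrpCat.{u + 1} :=
  ⟨derPresheaf J, derPresheaf_isSheaf J⟩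

/-- The same presheaf, as a sheaf for the topology of uniform lifts. -/
def derSheafUniform : Sheaf (uniformLiftTopology B) AddCommGrpCat.{u + 1} :=
  ⟨derPresheaf J, fun E =>
    Presieve.isSheaf_of_le _ uniformLiftTopology_le (derPresheaf_isSheaf J E)⟩

end TopAlg

/-! ### Presheaves of abelian groups and the next universe -/

namespace TopAlg

/-! Write `B` for `A[S]`. Embed the abelian sheaf underlying `J` in an injective abelian sheaf `I`.
Then `J` embeds in the coinduced module `Hom(B, I)` by `j ↦ (b ↦ b • j)`, and, being injective, is a
direct summand of it (`exists_coind_retraction`). A derivation of `X` into `Hom(B, I)` is a pairing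
`(x, b)` with values in `I`, biadditive, Leibniz and trivial on `A`. So `Der(-, J)` is a retract of
the kernel of `Hom(F₀(X), I) ⟶ Hom(F₁(X), I)`, where `F₀` is free abelian on pairs `(x, b)` and `F₁`
is free on the relations (`homPresheafMap_derFreeMap_eq_zero_iff`, `homToDer_derToHom`). Free covers
of kernels continue this to a sequence `F₀, F₁, F₂, …` of free abelian groups on finite tuples of
sections of `X`, decorated with data living on the small site.

Each `X ↦ Hom(Fₙ(X), I)` is an injective sheaf. A decorated tuple in `X` is a morphism to `X` from a
free algebra, so this functor of `I` has an exact left adjoint, a direct sum of evaluations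
(`Shape.injective_homPresheaf_free`). It is a sheaf because a tuple is finite and covering families
lift finite sets of sections to a single member (`Shape.isSheaf_homPresheaf_free`).

The sequence is exact on sections over every `X` that is, locally, a filtered colimit of polynomial
algebras. There a kernel element of `Fₙ` comes, locally, from a polynomial algebra, where the next
free cover hits it. As `I` is a separated presheaf and an injective object, exactness follows
(`exists_homPresheafMap_eq`). Every algebra is covered by a free one, which has this property
(`locallyIndPoly_freeAlgOn`), and so has the terminal object `A[S]`. Dimension shifting, with global
sections taken over the terminal object, then kills the cohomology of the kernel
(`subsingleton_H_kernel`), hence that of its retract.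

Of the topology only `uniformLiftTopology B ≤ τ ≤ liftTopology B` matters: the upper bound gives the
sheaf property, the lower one the covers by free algebras. -/

lemma free_hom_ext {α : Type*} {G : AddCommGrpCat}
    {f g : AddCommGrpCat.of (FreeAbelianGroup α) ⟶ G}
    (h : ∀ x : α, f (FreeAbelianGroup.of x) = g (FreeAbelianGroup.of x)) : f = g :=
  AddCommGrpCat.hom_ext (FreeAbelianGroup.lift_ext _ _ h)

section UniverseLift

variable {C : Type u} [SmallCategory C]

/-- Presheaves are the sheaves for the trivial topology. This makes Baer's criterion available in
the next universe. -/
instance isGrothendieckAbelian_presheaf :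
    IsGrothendieckAbelian.{u + 1} (Cᵒᵖ ⥤ AddCommGrpCat.{u + 1}) := by
  have : EssentiallySmall.{u + 1} C := essentiallySmallSelf.{u + 1, u, u} C
  have := Sheaf.isGrothendieckAbelian_of_essentiallySmall (⊥ : GrothendieckTopology C)
    AddCommGrpCat.{u + 1}
  exact IsGrothendieckAbelian.of_equivalence (sheafBotEquivalence _)

variable (C) in
/-- The direct sum of the free abelian presheaves on all objects. -/
def sumFreePresheaf : Cᵒᵖ ⥤ AddCommGrpCat.{u} where
  obj V := AddCommGrpCat.of (FreeAbelianGroup (Σ U : C, V.unop ⟶ U))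
  map g := AddCommGrpCat.ofHom (FreeAbelianGroup.map fun x => ⟨x.1, g.unop ≫ x.2⟩)
  map_id V := by
    refine free_hom_ext fun x => ?_
    simp
  map_comp f g := by
    refine free_hom_ext fun x => ?_
    simp

/-- The morphism out of `sumFreePresheaf` given by a family of sections. -/
def sumFreeDesc (N : Cᵒᵖ ⥤ AddCommGrpCat.{u + 1}) (x : ∀ U : C, N.obj (op U)) :
    sumFreePresheaf C ⋙ AddCommGrpCat.uliftFunctor.{u + 1, u} ⟶ N where
  app V := AddCommGrpCat.ofHom ((FreeAbelianGroup.lift fun y => N.map y.2.op (x y.1)).comp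
    AddEquiv.ulift.toAddMonoidHom)
  naturality V V' g := by
    have : ((FreeAbelianGroup.lift fun y : (Σ U : C, V'.unop ⟶ U) => N.map y.2.op (x y.1)).comp
        (FreeAbelianGroup.map fun y : (Σ U : C, V.unop ⟶ U) => ⟨y.1, g.unop ≫ y.2⟩)) =
        (N.map g).hom.comp (FreeAbelianGroup.lift fun y => N.map y.2.op (x y.1)) := by
      refine FreeAbelianGroup.lift_ext _ _ fun y => ?_
      simp
    ext ⟨y⟩
    exact DFunLike.congr_fun this y

lemma sumFreeDesc_app (N : Cᵒᵖ ⥤ AddCommGrpCat.{u + 1}) (x : ∀ U : C, N.obj (op U)) (U : C) :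
    (sumFreeDesc N x).app (op U) ⟨FreeAbelianGroup.of ⟨U, 𝟙 U⟩⟩ = x U := by
  change FreeAbelianGroup.lift (fun y : (Σ U' : C, U ⟶ U') => N.map y.2.op (x y.1))
    (FreeAbelianGroup.of ⟨U, 𝟙 U⟩) = x U
  simp

/-- By Yoneda, a section over `U`, completed by zero at all other objects, is a morphism out of the
sum. -/
lemma isSeparator_sumFreePresheaf :
    IsSeparator (sumFreePresheaf C ⋙ AddCommGrpCat.uliftFunctor.{u + 1, u}) := by
  classical
  rw [isSeparator_def]
  intro N N' f g h
  ext ⟨U⟩ x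
  have := h (sumFreeDesc N (Function.update 0 U x))
  have := congr(($this).app (op U) ⟨FreeAbelianGroup.of ⟨U, 𝟙 U⟩⟩)
  change f.app (op U) ((sumFreeDesc N _).app (op U) _) =
    g.app (op U) ((sumFreeDesc N _).app (op U) _) at this
  rw [sumFreeDesc_app, Function.update_self] at this
  exact this

/-- The small presheaf underlying a subobject of a presheaf of the form `G ⋙ ulift`. -/
def smallSub {G : Cᵒᵖ ⥤ AddCommGrpCat.{u}} {S : Cᵒᵖ ⥤ AddCommGrpCat.{u + 1}}
    (i : S ⟶ G ⋙ AddCommGrpCat.uliftFunctor.{u + 1, u}) : Cᵒᵖ ⥤ AddCommGrpCat.{u} where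
  obj V := AddCommGrpCat.of
    ((i.app V).hom.range.comap (AddEquiv.ulift.symm.toAddMonoidHom : G.obj V →+ _))
  map {V V'} g := AddCommGrpCat.ofHom (((G.map g).hom.comp (AddSubgroup.subtype _)).codRestrict _ (by
    rintro ⟨y, t, ht⟩
    refine ⟨S.map g t, ?_⟩
    exact (congr($(i.naturality g) t)).trans congr(ULift.up (G.map g (ULift.down $ht)))))
  map_id V := by ext ⟨x, hx⟩; exact congr($(G.map_id V) x)
  map_comp f g := by ext ⟨x, hx⟩; exact congr($(G.map_comp f g) x)

/-- The inclusion of `smallSub`. -/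
def smallSubι {G : Cᵒᵖ ⥤ AddCommGrpCat.{u}} {S : Cᵒᵖ ⥤ AddCommGrpCat.{u + 1}}
    (i : S ⟶ G ⋙ AddCommGrpCat.uliftFunctor.{u + 1, u}) : smallSub i ⟶ G where
  app V := AddCommGrpCat.ofHom (AddSubgroup.subtype _)

instance {G : Cᵒᵖ ⥤ AddCommGrpCat.{u}} {S : Cᵒᵖ ⥤ AddCommGrpCat.{u + 1}}
    (i : S ⟶ G ⋙ AddCommGrpCat.uliftFunctor.{u + 1, u}) : Mono (smallSubι i) := by
  rw [NatTrans.mono_iff_mono_app]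
  intro V
  rw [AddCommGrpCat.mono_iff_injective]
  exact Subtype.val_injective

/-- A subobject of a lifted presheaf has a copy `smallSub i` in the small universe. The extension
problem is solved there and the solution is lifted back. -/
lemma extend_along_mono_uliftFunctor (I : Cᵒᵖ ⥤ AddCommGrpCat.{u}) [Injective I]
    {G : Cᵒᵖ ⥤ AddCommGrpCat.{u}} {S : Cᵒᵖ ⥤ AddCommGrpCat.{u + 1}}
    (i : S ⟶ G ⋙ AddCommGrpCat.uliftFunctor.{u + 1, u}) [Mono i]
    (f : S ⟶ I ⋙ AddCommGrpCat.uliftFunctor.{u + 1, u}) :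
    ∃ g : G ⋙ AddCommGrpCat.uliftFunctor.{u + 1, u} ⟶ I ⋙ AddCommGrpCat.uliftFunctor.{u + 1, u},
      i ≫ g = f := by
  have hi : ∀ V, Function.Injective (i.app V) := fun V => by
    rw [← AddCommGrpCat.mono_iff_injective]; infer_instance
  -- Preimages under the injective `i` are unique (`htu`), which makes `t` additive and natural.
  choose t ht using fun (V : Cᵒᵖ) (y : (smallSub i).obj V) => y.2
  have htu : ∀ (V : Cᵒᵖ) (y : (smallSub i).obj V) (s : S.obj V),
      i.app V s = ULift.up y.1 → t V y = s := fun V y s hs => hi V ((ht V y).trans hs.symm)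
  let f' : smallSub i ⟶ I :=
    { app V := AddCommGrpCat.ofHom (AddEquiv.ulift.toAddMonoidHom.comp ((f.app V).hom.comp
        (AddMonoidHom.mk' (t V) fun a b => htu V _ _ (by
          rw [map_add]; exact congr($(ht V a) + $(ht V b))))))
      naturality V V' g := by
        ext y
        have h₁ : t V' ((smallSub i).map g y) = S.map g (t V y) := htu V' _ _ (by
          exact (congr($(i.naturality g) (t V y))).trans
            congr((G ⋙ AddCommGrpCat.uliftFunctor.{u + 1, u}).map g $(ht V y)))
        change (f.app V' (t V' ((smallSub i).map g y))).down = I.map g (f.app V (t V y)).down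
        rw [h₁]
        exact congr(($(f.naturality g) (t V y)).down) }
  refine ⟨Functor.whiskerRight (Injective.factorThru f' (smallSubι i)) _, ?_⟩
  ext V s
  let y : (smallSub i).obj V := ⟨(i.app V s).down, s, rfl⟩
  have := congr(($(Injective.comp_factorThru f' (smallSubι i))).app V y)
  refine (congrArg ULift.up this).trans ?_
  change f.app V (t V y) = f.app V s
  rw [htu V y s rfl]

/-- Baer's criterion: it suffices to extend from subobjects of a separator, and a separator can be
chosen among the lifts of small presheaves. -/
lemma injective_comp_uliftFunctor (I : Cᵒᵖ ⥤ AddCommGrpCat.{u}) [Injective I] :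
    Injective (I ⋙ AddCommGrpCat.uliftFunctor.{u + 1, u}) := by
  rw [injective_iff_rlp_monomorphisms_zero,
    ← IsGrothendieckAbelian.generatingMonomorphisms_rlp isSeparator_sumFreePresheaf]
  rintro _ _ _ ⟨S⟩
  refine ⟨fun {f _} sq => ?_⟩
  obtain ⟨g, hg⟩ := extend_along_mono_uliftFunctor I S.arrow f
  exact ⟨⟨⟨g, hg, (isZero_zero _).eq_of_tgt _ _⟩⟩⟩

end UniverseLift
end TopAlg

/-! ### Cohomology from a resolution by injective sheaves -/

namespace TopAlg

/-- In the long exact sequence `Ext^{p+1}(Z, X₁)` lies between a surjective map to `Ext^p(Z, X₃)`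
and a zero group. -/
lemma subsingleton_ext_of_shortExact {𝒜 : Type*} [Category 𝒜] [Abelian 𝒜] [HasExt 𝒜] {Z : 𝒜}
    {S : ShortComplex 𝒜} (hS : S.ShortExact) {p : ℕ} [Subsingleton (Abelian.Ext Z S.X₂ (p + 1))]
    (h : ∀ z : Abelian.Ext Z S.X₃ p, ∃ y : Abelian.Ext Z S.X₂ p,
      y.comp (Abelian.Ext.mk₀ S.g) (add_zero p) = z) :
    Subsingleton (Abelian.Ext Z S.X₁ (p + 1)) := by
  refine subsingleton_of_forall_eq 0 fun x => ?_
  obtain ⟨z, rfl⟩ := Abelian.Ext.covariant_sequence_exact₁ _ hS x (Subsingleton.elim _ _) rfl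
  obtain ⟨y, rfl⟩ := h z
  rw [Abelian.Ext.comp_assoc_of_second_deg_zero, hS.comp_extClass, Abelian.Ext.comp_zero]

section Resolution

variable {D : Type (u + 1)} [Category.{u} D] {τ : GrothendieckTopology D}

lemma subsingleton_H_of_mono_split {F G : Sheaf τ AddCommGrpCat.{u + 1}} (i : F ⟶ G) (r : G ⟶ F)
    (h : i ≫ r = 𝟙 F) (p : ℕ) [Subsingleton (Sheaf.H.{u + 1} G p)] :
    Subsingleton (Sheaf.H.{u + 1} F p) := by
  refine ⟨fun x y => ?_⟩
  rw [← Sheaf.H.map_id_apply x, ← Sheaf.H.map_id_apply y, ← h, Sheaf.H.map_comp_apply,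
    Sheaf.H.map_comp_apply, Subsingleton.elim (Sheaf.H.map i p x) (Sheaf.H.map i p y)]

lemma kernel_ι_injective {F G : Sheaf τ AddCommGrpCat.{u + 1}} (f : F ⟶ G) (X : Dᵒᵖ) :
    Function.Injective ((kernel.ι f).hom.app X) := by
  rw [← AddCommGrpCat.mono_iff_injective]
  change Mono ((sheafToPresheaf τ AddCommGrpCat.{u + 1} ⋙ (evaluation _ _).obj X).map (kernel.ι f))
  infer_instance

variable (L : ℕ → Sheaf τ AddCommGrpCat.{u + 1}) (d : ∀ n, L n ⟶ L (n + 1))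

/-- If a sequence of injective abelian sheaves is exact on sections over the objects of a class
that contains the terminal object and covers every object, then the kernel of its first
morphism has no higher cohomology. -/
lemma subsingleton_H_kernel [∀ n, Injective (L n)] (hd : ∀ n, d n ≫ d (n + 1) = 0)
    (P : D → Prop)
    (hP : ∀ X, ∃ (Y : D) (f : Y ⟶ X), P Y ∧ Sieve.generate (Presieve.singleton f) ∈ τ X)
    {T : D} (hT : IsTerminal T) (hPT : P T)
    (hex : ∀ n (X : D), P X → ∀ y : (L (n + 1)).obj.obj (op X), (d (n + 1)).hom.app (op X) y = 0 →
      ∃ x, (d n).hom.app (op X) x = y) (p n : ℕ) :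
    Subsingleton (Sheaf.H.{u + 1} (kernel (d n)) (p + 1)) := by
  have key : ∀ n, ∃ q : L n ⟶ kernel (d (n + 1)), q ≫ kernel.ι _ = d n := fun n =>
    ⟨kernel.lift _ _ (hd n), kernel.lift_ι _ _ _⟩
  choose q hq using key
  have surj : ∀ n (X : D), P X → ∀ y : (kernel (d (n + 1))).obj.obj (op X),
      ∃ x, (q n).hom.app (op X) x = y := by
    intro n X hX y
    obtain ⟨x, hx⟩ := hex n X hX ((kernel.ι (d (n + 1))).hom.app (op X) y)
      congr(($(kernel.condition (d (n + 1)))).hom.app (op X) y)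
    refine ⟨x, kernel_ι_injective _ _ ?_⟩
    rw [← hx]
    exact congr(($(hq n)).hom.app (op X) x)
  -- Surjectivity on sections over objects in `P` is local surjectivity, because such objects cover.
  have hepi : ∀ n, Epi (q n) := by
    intro n
    rw [← Sheaf.isLocallySurjective_iff_epi']
    refine ⟨fun {X} s => ?_⟩
    obtain ⟨Y, f, hY, hf⟩ := hP X
    refine τ.superset_covering ?_ hf
    rw [Sieve.generate_le_iff]
    rintro _ _ ⟨⟩
    exact surj n _ hY _
  -- The sequence splits into short exact pieces `0 ⟶ ker dₙ ⟶ Lₙ ⟶ ker dₙ₊₁ ⟶ 0`, whose middle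
  -- terms are acyclic.
  have hS : ∀ n, (ShortComplex.mk (kernel.ι (d n)) (q n) (by
      rw [← cancel_mono (kernel.ι _), Category.assoc, hq, kernel.condition,
        zero_comp])).ShortExact := by
    intro n
    have := hepi n
    refine { exact := ShortComplex.exact_of_f_is_kernel _ ?_,
             mono_f := by dsimp; infer_instance, epi_g := this }
    exact isKernelOfComp _ _ (kernelIsKernel (d n)) _ (hq n)
  induction p generalizing n with
  | zero =>
    -- `H⁰` is the group of sections over the terminal object `T`, which satisfies `P`; hence `q n`
    -- is surjective on `H⁰`.
    refine subsingleton_ext_of_shortExact (hS n) fun z => ?_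
    obtain ⟨x, hx⟩ := surj n T hPT (Sheaf.H.equiv₀ _ hT z)
    refine ⟨(Sheaf.H.equiv₀ _ hT).symm x, ?_⟩
    refine (Sheaf.H.equiv₀_symm_naturality hT (q n) x).trans ?_
    rw [hx, AddEquiv.symm_apply_apply]
  | succ p ih =>
    have := ih (n + 1)
    exact subsingleton_ext_of_shortExact (hS n) fun z => ⟨0, Subsingleton.elim _ _⟩

end Resolution
end TopAlg

/-! ### Stages of algebras and shapes of tuples -/

namespace TopAlg

variable {C : Type u} [SmallCategory C] {K : GrothendieckTopology C}
variable {A : Sheaf K CommRingCat.{u}} {B : Under A}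

/-- The restriction of sections of `B`. -/
abbrev bres (B : Under A) {U V : Cᵒᵖ} (g : U ⟶ V) :
    B.right.obj.obj U →+* B.right.obj.obj V :=
  (B.right.obj.map g).hom

/-- The structure map from `A` to `B` on sections. -/
abbrev bstr (B : Under A) (U : Cᵒᵖ) : A.obj.obj U →+* B.right.obj.obj U :=
  (B.hom.hom.app U).hom

lemma bres_id (U : Cᵒᵖ) (b : B.right.obj.obj U) : bres B (𝟙 U) b = b :=
  congr($(B.right.obj.map_id U) b)

lemma bres_comp {U V W : Cᵒᵖ} (g : U ⟶ V) (h : V ⟶ W) (b : B.right.obj.obj U) :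
    bres B (g ≫ h) b = bres B h (bres B g b) :=
  congr($(B.right.obj.map_comp g h) b)

lemma augMap_structMap (X : Over B) (U : Cᵒᵖ) (a : A.obj.obj U) :
    augMap X U (structMap X U a) = bstr B U a :=
  congr(($(Under.w X.hom)).hom.app U a)

lemma augMap_res (X : Over B) {U V : Cᵒᵖ} (g : U ⟶ V) (x : Sec X U) :
    augMap X V (res X g x) = bres B g (augMap X U x) :=
  congr($(X.hom.right.hom.naturality g) x)

lemma structMap_res (X : Over B) {U V : Cᵒᵖ} (g : U ⟶ V) (a : A.obj.obj U) :
    structMap X V (A.obj.map g a) = res X g (structMap X U a) :=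
  congr($(X.left.hom.hom.naturality g) a)

lemma res_id (X : Over B) (U : Cᵒᵖ) (x : Sec X U) : res X (𝟙 U) x = x :=
  congr($(X.left.right.obj.map_id U) x)

variable (B) in
/-- An `A(V)`-algebra over `B(V)`, for some object `V` of the site. -/
structure Stage where
  /-- the object of the site -/
  base : Cᵒᵖ
  /-- the underlying ring -/
  ring : CommRingCat.{u}
  /-- the algebra structure -/
  str : A.obj.obj base →+* ring
  /-- the map to `B` -/
  aug : ring →+* B.right.obj.obj base
  comm : ∀ a, aug (str a) = bstr B base a

namespace Stage

/-- A morphism of stages: a restriction map together with a compatible ring homomorphism. -/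
@[ext]
structure Hom (Q R : Stage B) where
  /-- the map of the site -/
  base : Q.base ⟶ R.base
  /-- the ring homomorphism -/
  map : Q.ring →+* R.ring
  str_comm : ∀ a, map (Q.str a) = R.str (A.obj.map base a)
  aug_comm : ∀ x, R.aug (map x) = bres B base (Q.aug x)

instance : Category (Stage B) where
  Hom := Hom
  id Q := ⟨𝟙 _, RingHom.id _, fun a => by simp, fun x => (bres_id _ _).symm⟩
  comp f g := ⟨f.base ≫ g.base, g.map.comp f.map,
    fun a => by simp [f.str_comm, g.str_comm],
    fun x => by simp only [RingHom.comp_apply, g.aug_comm, f.aug_comm, bres_comp]⟩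

@[ext]
lemma hom_ext {Q R : Stage B} {f g : Q ⟶ R} (h₁ : f.base = g.base) (h₂ : ∀ x, f.map x = g.map x) :
    f = g :=
  Hom.ext h₁ (RingHom.ext h₂)

/-- The polynomial algebra in `n` variables, with given images of the variables in `B`. -/
noncomputable def poly (V : Cᵒᵖ) {n : ℕ} (b : Fin n → B.right.obj.obj V) : Stage B where
  base := V
  ring := CommRingCat.of (MvPolynomial (Fin n) (A.obj.obj V))
  str := MvPolynomial.C
  aug := MvPolynomial.eval₂Hom (bstr B V) b
  comm a := by simp

/-- The morphism from a polynomial algebra given by the images of the variables. -/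
noncomputable def polyDesc {V : Cᵒᵖ} {n : ℕ} {b : Fin n → B.right.obj.obj V} {Q : Stage B}
    (g : V ⟶ Q.base) (q : Fin n → Q.ring) (h : ∀ j, Q.aug (q j) = bres B g (b j)) :
    poly V b ⟶ Q where
  base := g
  map := MvPolynomial.eval₂Hom (Q.str.comp (A.obj.map g).hom) q
  str_comm a := MvPolynomial.eval₂_C _ _ _
  aug_comm x := by
    have : Q.aug.comp (MvPolynomial.eval₂Hom (Q.str.comp (A.obj.map g).hom) q) =
        (bres B g).comp (MvPolynomial.eval₂Hom (bstr B V) b) := by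
      refine MvPolynomial.ringHom_ext (fun a => ?_) (fun j => ?_)
      · simp [Q.comm]
      · simp [h]
    exact DFunLike.congr_fun this x

@[simp] lemma polyDesc_base {V : Cᵒᵖ} {n : ℕ} {b : Fin n → B.right.obj.obj V} {Q : Stage B}
    (g : V ⟶ Q.base) (q : Fin n → Q.ring) (h : ∀ j, Q.aug (q j) = bres B g (b j)) :
    (polyDesc g q h : poly V b ⟶ Q).base = g := rfl

/-- The variables of a polynomial algebra. -/
noncomputable def var {V : Cᵒᵖ} {n : ℕ} (b : Fin n → B.right.obj.obj V) (j : Fin n) :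
    (poly V b).ring := MvPolynomial.X j

@[simp] lemma polyDesc_var {V : Cᵒᵖ} {n : ℕ} {b : Fin n → B.right.obj.obj V} {Q : Stage B}
    (g : V ⟶ Q.base) (q : Fin n → Q.ring) (h : ∀ j, Q.aug (q j) = bres B g (b j)) (j : Fin n) :
    (polyDesc g q h : poly V b ⟶ Q).map (var b j) = q j :=
  MvPolynomial.eval₂_X _ _ _

@[simp] lemma aug_var {V : Cᵒᵖ} {n : ℕ} (b : Fin n → B.right.obj.obj V) (j : Fin n) :
    (poly V b).aug (var b j) = b j :=
  MvPolynomial.eval₂_X _ _ _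

lemma poly_hom_ext {V : Cᵒᵖ} {n : ℕ} {b : Fin n → B.right.obj.obj V} {Q : Stage B}
    {f g : poly V b ⟶ Q} (h₁ : f.base = g.base) (h₂ : ∀ j, f.map (var b j) = g.map (var b j)) :
    f = g := by
  refine Hom.ext h₁ (MvPolynomial.ringHom_ext (fun a => ?_) h₂)
  have hf := f.str_comm a
  have hg := g.str_comm a
  rw [h₁] at hf
  exact hf.trans hg.symm

/-- The stages of an algebra over `B`. -/
def ofAlg (X : Over B) : Cᵒᵖ ⥤ Stage B where
  obj V := ⟨V, Sec X V, structMap X V, augMap X V, augMap_structMap X V⟩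
  map g := ⟨g, res X g, fun a => (structMap_res X g a).symm, fun x => augMap_res X g x⟩
  map_id V := hom_ext rfl fun x => res_id X V x
  map_comp g h := hom_ext rfl fun x => res_comp X g h x

variable (B) in
/-- The functor sending an algebra over `B` to its stages. -/
def ofAlgFunctor : Over B ⥤ Cᵒᵖ ⥤ Stage B where
  obj := ofAlg
  map {Y X} f :=
    { app V := ⟨𝟙 V, secMap f V, fun a =>
          (secMap_structMap f V a).trans
            (congrArg (structMap X V) congr($(A.obj.map_id V) a)).symm, fun x => by
          have := augMap_secMap f V x
          exact this.trans (bres_id _ _).symm⟩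
      naturality U V g :=
        hom_ext ((Category.comp_id g).trans (Category.id_comp g).symm) fun x => secMap_res f g x }
  map_id X := by ext V; exacts [rfl, rfl]
  map_comp f g := by
    ext V x
    · exact (Category.comp_id (𝟙 V)).symm
    · rfl

end Stage

variable (B) in
/-- A family of "shapes" of tuples: an element of the associated functor on stages is a tuple of
elements of an algebra, decorated with a section of a presheaf that determines its image in `B`. -/
structure Shape where
  /-- the indices of the family -/
  ι : Type (u + 1)
  /-- the length of the tuples -/
  n : ι → ℕ
  /-- the presheaf of decorations -/
  N : ι → Cᵒᵖ → Type (u + 1)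
  /-- restriction of decorations -/
  res : ∀ i {U V : Cᵒᵖ}, (U ⟶ V) → N i U → N i V
  res_id : ∀ i {U : Cᵒᵖ} (ν : N i U), res i (𝟙 U) ν = ν
  res_comp : ∀ i {U V W : Cᵒᵖ} (g : U ⟶ V) (h : V ⟶ W) (ν : N i U),
    res i (g ≫ h) ν = res i h (res i g ν)
  /-- the image of the tuple in `B` -/
  β : ∀ i {U : Cᵒᵖ}, N i U → Fin (n i) → B.right.obj.obj U
  β_res : ∀ i {U V : Cᵒᵖ} (g : U ⟶ V) (ν : N i U) j, β i (res i g ν) j = bres B g (β i ν j)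

namespace Shape

/-- Decorated tuples of elements of an algebra. -/
structure El (W : Shape B) (Q : Stage B) where
  /-- the index -/
  i : W.ι
  /-- the decoration -/
  ν : W.N i Q.base
  /-- the tuple -/
  q : Fin (W.n i) → Q.ring
  aug_q : ∀ j, Q.aug (q j) = W.β i ν j

variable (W : Shape B)

variable {W} in
/-- Functoriality of decorated tuples. -/
def El.map {Q R : Stage B} (f : Q ⟶ R) (w : El W Q) : El W R where
  i := w.i
  ν := W.res _ f.base w.ν
  q j := f.map (w.q j)
  aug_q j := by rw [f.aug_comm, w.aug_q, W.β_res]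

variable {W} in
lemma El.ext' {Q : Stage B} {i : W.ι} {ν ν' : W.N i Q.base} {q q' : Fin (W.n i) → Q.ring} {h h'}
    (h₁ : ν = ν') (h₂ : q = q') : (⟨i, ν, q, h⟩ : El W Q) = ⟨i, ν', q', h'⟩ := by
  subst h₁ h₂; rfl

variable {W} in
lemma El.map_id {Q : Stage B} (w : El W Q) : w.map (𝟙 Q) = w :=
  El.ext' (W.res_id _ _) rfl

variable {W} in
lemma El.map_comp {Q R S : Stage B} (f : Q ⟶ R) (g : R ⟶ S) (w : El W Q) :
    w.map (f ≫ g) = (w.map f).map g :=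
  El.ext' (W.res_comp _ _ _ _) rfl

/-- The free abelian group on decorated tuples. -/
def free : Stage B ⥤ AddCommGrpCat.{u + 1} where
  obj Q := AddCommGrpCat.of (FreeAbelianGroup (El W Q))
  map f := AddCommGrpCat.ofHom (FreeAbelianGroup.map (El.map f))
  map_id Q := free_hom_ext fun w => by simp [El.map_id]
  map_comp f g := free_hom_ext fun w => by simp [El.map_comp]

/-- The generators of the free abelian group on decorated tuples. -/
def of {Q : Stage B} (w : El W Q) : W.free.obj Q := FreeAbelianGroup.of w

lemma free_map_of {Q R : Stage B} (f : Q ⟶ R) (w : El W Q) :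
    W.free.map f (W.of w) = W.of (w.map f) :=
  FreeAbelianGroup.map_of_apply w

/-- A morphism out of `W.free` is given by a natural map on decorated tuples. -/
def freeDesc {M : Stage B ⥤ AddCommGrpCat.{u + 1}} (φ : ∀ Q, El W Q → M.obj Q)
    (hφ : ∀ {Q R : Stage B} (f : Q ⟶ R) (w : El W Q), φ R (w.map f) = M.map f (φ Q w)) :
    W.free ⟶ M where
  app Q := AddCommGrpCat.ofHom (FreeAbelianGroup.lift (φ Q))
  naturality Q R f := free_hom_ext fun w => by simp [free, hφ]

lemma freeDesc_of {M : Stage B ⥤ AddCommGrpCat.{u + 1}} (φ : ∀ Q, El W Q → M.obj Q) (hφ)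
    {Q : Stage B} (w : El W Q) : (W.freeDesc φ hφ).app Q (W.of w) = φ Q w :=
  FreeAbelianGroup.lift_apply_of _ _

end Shape

section HomPresheaf

variable (I : Cᵒᵖ ⥤ AddCommGrpCat.{u + 1})

/-- The presheaf `X ↦ Hom(M(X), I)` on algebras over `B`. -/
def homPresheaf (M : Stage B ⥤ AddCommGrpCat.{u + 1}) : (Over B)ᵒᵖ ⥤ AddCommGrpCat.{u + 1} :=
  (Stage.ofAlgFunctor B ⋙ (Functor.whiskeringRight _ _ _).obj M).op ⋙ preadditiveYoneda.obj I

/-- The functoriality of `homPresheaf`. -/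
def homPresheafMap {M M' : Stage B ⥤ AddCommGrpCat.{u + 1}} (α : M ⟶ M') :
    homPresheaf I M' ⟶ homPresheaf I M :=
  Functor.whiskerRight (NatTrans.op (Functor.whiskerLeft (Stage.ofAlgFunctor B)
    ((Functor.whiskeringRight _ _ _).map α))) (preadditiveYoneda.obj I)

end HomPresheaf

end TopAlg

/-! ### Free algebras on presheaves of sets -/

namespace TopAlg

variable {C : Type u} [SmallCategory C] {K : GrothendieckTopology C}

section FreeAlgebraOn

variable (A : Sheaf K CommRingCat.{u}) (S : Cᵒᵖ ⥤ Type u)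

/-- The presheaf of polynomial algebras on a presheaf of sets. -/
noncomputable def polyPresheafOn : Cᵒᵖ ⥤ CommRingCat.{u} where
  obj U := CommRingCat.of (MvPolynomial (S.obj U) (A.obj.obj U))
  map f := CommRingCat.ofHom (MvPolynomial.eval₂Hom (MvPolynomial.C.comp (A.obj.map f).hom)
    (fun s => MvPolynomial.X (S.map f s)))
  map_id U := by
    ext : 1
    apply MvPolynomial.ringHom_ext <;> intro x <;> simp
  map_comp f g := by
    ext : 1
    apply MvPolynomial.ringHom_ext <;> intro x <;> simp

/-- The inclusion of the constants. -/
noncomputable def polyConstOn : A.obj ⟶ polyPresheafOn A S where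
  app U := CommRingCat.ofHom MvPolynomial.C
  naturality U V f := by
    ext x
    simp [polyPresheafOn]

/-- The free `A`-algebra on a presheaf of sets. -/
noncomputable def freeAlgOn : Under A :=
  Under.mk (Y := (presheafToSheaf K CommRingCat.{u}).obj (polyPresheafOn A S))
    ⟨polyConstOn A S ≫ toSheafify K (polyPresheafOn A S)⟩

variable {A S}

/-- The generators of the free algebra. -/
noncomputable def freeAlgGen (V : Cᵒᵖ) (s : S.obj V) : (freeAlgOn A S).right.obj.obj V :=
  (toSheafify K (polyPresheafOn A S)).app V (MvPolynomial.X s : MvPolynomial _ _)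

lemma freeAlgGen_map {U V : Cᵒᵖ} (g : U ⟶ V) (s : S.obj U) :
    (freeAlgOn A S).right.obj.map g (freeAlgGen U s) = freeAlgGen V (S.map g s) := by
  have := congr($((toSheafify K (polyPresheafOn A S)).naturality g)
    (MvPolynomial.X s : MvPolynomial _ _))
  refine this.symm.trans ?_
  exact congrArg ((toSheafify K (polyPresheafOn A S)).app V) (MvPolynomial.eval₂_X _ _ _)

lemma freeAlgOn_hom_ext {Y : Under A} {f g : freeAlgOn A S ⟶ Y}
    (h : ∀ V (s : S.obj V), f.right.hom.app V (freeAlgGen V s) =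
      g.right.hom.app V (freeAlgGen V s)) : f = g := by
  refine Under.UnderMorphism.ext ?_
  apply Sheaf.hom_ext
  refine sheafify_hom_ext K _ _ Y.right.property ?_
  ext V : 2
  refine CommRingCat.hom_ext (MvPolynomial.ringHom_ext (fun a => ?_) (h V))
  have hf := congr(($(Under.w f)).hom.app V a)
  have hg := congr(($(Under.w g)).hom.app V a)
  exact hf.trans hg.symm

/-- The morphism from the presheaf of polynomial algebras given by the images of the variables. -/
noncomputable def polyPresheafOnDesc {Y : Under A} (φ : ∀ V, S.obj V → Y.right.obj.obj V)
    (hφ : ∀ {U V : Cᵒᵖ} (g : U ⟶ V) (s : S.obj U), φ V (S.map g s) = Y.right.obj.map g (φ U s)) :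
    polyPresheafOn A S ⟶ Y.right.obj where
  app V := CommRingCat.ofHom (MvPolynomial.eval₂Hom (Y.hom.hom.app V).hom (φ V))
  naturality U V g := by
    refine CommRingCat.hom_ext (MvPolynomial.ringHom_ext (fun a => ?_) (fun s => ?_))
    · simp [polyPresheafOn]
    · simp [polyPresheafOn, hφ]

/-- The morphism from a free algebra given by the images of the generators. -/
noncomputable def freeAlgDesc {Y : Under A} (φ : ∀ V, S.obj V → Y.right.obj.obj V)
    (hφ : ∀ {U V : Cᵒᵖ} (g : U ⟶ V) (s : S.obj U), φ V (S.map g s) = Y.right.obj.map g (φ U s)) :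
    freeAlgOn A S ⟶ Y :=
  Under.homMk ⟨sheafifyLift K (polyPresheafOnDesc φ hφ) Y.right.property⟩ (by
    apply Sheaf.hom_ext
    change (polyConstOn A S ≫ toSheafify K (polyPresheafOn A S)) ≫ sheafifyLift K _ _ = _
    rw [Category.assoc, toSheafify_sheafifyLift]
    ext V a
    exact MvPolynomial.eval₂_C _ _ _)

lemma freeAlgDesc_gen {Y : Under A} (φ : ∀ V, S.obj V → Y.right.obj.obj V)
    (hφ : ∀ {U V : Cᵒᵖ} (g : U ⟶ V) (s : S.obj U), φ V (S.map g s) = Y.right.obj.map g (φ U s))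
    (V : Cᵒᵖ) (s : S.obj V) :
    (freeAlgDesc φ hφ).right.hom.app V (freeAlgGen V s) = φ V s := by
  refine (congr(($(toSheafify_sheafifyLift K (polyPresheafOnDesc φ hφ) Y.right.property)).app V
    (MvPolynomial.X s : MvPolynomial _ _))).trans ?_
  exact MvPolynomial.eval₂_X _ _ _

end FreeAlgebraOn

variable {A : Sheaf K CommRingCat.{u}} {B : Under A}

/-- The presheaf of sets freely generated by `n` sections over `V`. -/
def freeSections (V : Cᵒᵖ) (n : ℕ) : Cᵒᵖ ⥤ Type u where
  obj U := (V ⟶ U) × Fin n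
  map g := ↾fun x => (x.1 ≫ g, x.2)

/-- The free algebra over `B` on `n` sections over `V` with given images in `B`. -/
noncomputable def freeOver (V : Cᵒᵖ) {n : ℕ} (b : Fin n → B.right.obj.obj V) : Over B :=
  Over.mk (Y := freeAlgOn A (freeSections V n))
    (freeAlgDesc (fun _ s => bres B s.1 (b s.2)) (fun g s => bres_comp s.1 g _))

/-- The universal sections of `freeOver V b`. -/
noncomputable def freeOverGen {V : Cᵒᵖ} {n : ℕ} (b : Fin n → B.right.obj.obj V) (j : Fin n) :
    Sec (freeOver V b) V :=
  freeAlgGen V ((𝟙 V, j) : (V ⟶ V) × Fin n)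

lemma augMap_freeAlgGen {V : Cᵒᵖ} {n : ℕ} (b : Fin n → B.right.obj.obj V) (U : Cᵒᵖ)
    (s : (freeSections V n).obj U) :
    augMap (freeOver V b) U (freeAlgGen U s) = bres B s.1 (b s.2) :=
  freeAlgDesc_gen (S := freeSections V n) _ (fun g s => bres_comp s.1 g _) U s

lemma augMap_freeOverGen {V : Cᵒᵖ} {n : ℕ} (b : Fin n → B.right.obj.obj V) (j : Fin n) :
    augMap (freeOver V b) V (freeOverGen b j) = b j :=
  (augMap_freeAlgGen b V (𝟙 V, j)).trans (bres_id _ _)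

/-- With `freeOver_hom_ext` this is the universal property: `freeOver V b` represents the functor of
tuples in `X(V)` lying over `b`. -/
lemma exists_freeOver_hom {V : Cᵒᵖ} {n : ℕ} (b : Fin n → B.right.obj.obj V) (X : Over B)
    (q : Fin n → Sec X V) (hq : ∀ j, augMap X V (q j) = b j) :
    ∃ φ : freeOver V b ⟶ X, ∀ j, secMap φ V (freeOverGen b j) = q j := by
  have key := freeAlgDesc_gen (S := freeSections V n) (Y := X.left) (fun _ s => res X s.1 (q s.2))
    (fun g s => res_comp X s.1 g _)
  refine ⟨Over.homMk (freeAlgDesc (fun _ s => res X s.1 (q s.2)) (fun g s => res_comp X s.1 g _))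
    ?_, fun j => ?_⟩
  · refine freeAlgOn_hom_ext fun U s => ?_
    refine Eq.trans ?_ (augMap_freeAlgGen b U s).symm
    refine (congrArg (augMap X U) (key U s)).trans ?_
    rw [augMap_res, hq]
  · exact (key V (𝟙 V, j)).trans (res_id _ _ _)

lemma freeOver_hom_ext {V : Cᵒᵖ} {n : ℕ} {b : Fin n → B.right.obj.obj V} {X : Over B}
    {f g : freeOver V b ⟶ X}
    (h : ∀ j, secMap f V (freeOverGen b j) = secMap g V (freeOverGen b j)) : f = g := by
  refine Over.OverMorphism.ext (freeAlgOn_hom_ext fun U s => ?_)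
  have : (freeAlgGen U s : Sec (freeOver V b) U) = res _ s.1 (freeOverGen b s.2) := by
    refine Eq.trans ?_ (freeAlgGen_map _ _).symm
    congr 1
    exact Prod.ext (Category.id_comp _).symm rfl
  change secMap f U (freeAlgGen U s) = secMap g U (freeAlgGen U s)
  rw [this, secMap_res, secMap_res, h]

end TopAlg

/-! ### Injectivity of the presheaf of homomorphisms -/

namespace TopAlg

variable {C : Type u} [SmallCategory C] {K : GrothendieckTopology C}
variable {A : Sheaf K CommRingCat.{u}} {B : Under A}

/-- The stage of an algebra `X` over `B` at an object of the site. -/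
abbrev atStage (X : Over B) (V : Cᵒᵖ) : Stage B := (Stage.ofAlg X).obj V

/-- The restriction map between stages of an algebra over `B`. -/
abbrev atRes (X : Over B) {U V : Cᵒᵖ} (g : U ⟶ V) : atStage X U ⟶ atStage X V :=
  (Stage.ofAlg X).map g

/-- The map between stages induced by a morphism of algebras over `B`. -/
abbrev atMap {Y X : Over B} (f : Y ⟶ X) (V : Cᵒᵖ) : atStage Y V ⟶ atStage X V :=
  ((Stage.ofAlgFunctor B).map f).app V

lemma atMap_atRes {Y X : Over B} (f : Y ⟶ X) {U V : Cᵒᵖ} (g : U ⟶ V) :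
    atMap f U ≫ atRes X g = atRes Y g ≫ atMap f V :=
  (((Stage.ofAlgFunctor B).map f).naturality g).symm

lemma atMap_comp {Z Y X : Over B} (f : Z ⟶ Y) (g : Y ⟶ X) (V : Cᵒᵖ) :
    atMap (f ≫ g) V = atMap f V ≫ atMap g V :=
  congr(($((Stage.ofAlgFunctor B).map_comp f g)).app V)

lemma atMap_id (X : Over B) (V : Cᵒᵖ) : atMap (𝟙 X) V = 𝟙 _ :=
  congr(($((Stage.ofAlgFunctor B).map_id X)).app V)

lemma atRes_id (X : Over B) (V : Cᵒᵖ) : atRes X (𝟙 V) = 𝟙 _ := (Stage.ofAlg X).map_id V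

lemma atRes_comp (X : Over B) {U V W : Cᵒᵖ} (g : U ⟶ V) (h : V ⟶ W) :
    atRes X (g ≫ h) = atRes X g ≫ atRes X h := (Stage.ofAlg X).map_comp g h

section HomPresheaf

variable {I : Cᵒᵖ ⥤ AddCommGrpCat.{u + 1}} {M M' : Stage B ⥤ AddCommGrpCat.{u + 1}}

/-- The components of a section of `homPresheaf`. -/
def homEv {X : Over B} (y : (homPresheaf I M).obj (op X)) (V : Cᵒᵖ) :
    M.obj (atStage X V) →+ I.obj V :=
  (show Stage.ofAlg X ⋙ M ⟶ I from y).app V |>.hom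

lemma homEv_res {X : Over B} (y : (homPresheaf I M).obj (op X)) {U V : Cᵒᵖ} (g : U ⟶ V)
    (m : M.obj (atStage X U)) :
    homEv y V (M.map (atRes X g) m) = I.map g (homEv y U m) :=
  congr($((show Stage.ofAlg X ⋙ M ⟶ I from y).naturality g) m)

lemma homEv_ext {X : Over B} {y z : (homPresheaf I M).obj (op X)}
    (h : ∀ V m, homEv y V m = homEv z V m) : y = z := by
  change (show Stage.ofAlg X ⋙ M ⟶ I from y) = z
  ext V m
  exact h V m

/-- A section of `homPresheaf` from its components. -/
def homMk {X : Over B} (y : ∀ V, M.obj (atStage X V) →+ I.obj V)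
    (hy : ∀ {U V : Cᵒᵖ} (g : U ⟶ V) (m : M.obj (atStage X U)),
      y V (M.map (atRes X g) m) = I.map g (y U m)) : (homPresheaf I M).obj (op X) :=
  show Stage.ofAlg X ⋙ M ⟶ I from
    { app V := AddCommGrpCat.ofHom (y V)
      naturality U V g := by ext m; exact hy g m }

lemma homEv_add {X : Over B} (y z : (homPresheaf I M).obj (op X)) (V : Cᵒᵖ)
    (m : M.obj (atStage X V)) : homEv (y + z) V m = homEv y V m + homEv z V m := rfl

lemma homEv_map {Y X : Over B} (f : Y ⟶ X) (y : (homPresheaf I M).obj (op X)) (V : Cᵒᵖ)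
    (m : M.obj (atStage Y V)) :
    homEv ((homPresheaf I M).map f.op y) V m = homEv y V (M.map (atMap f V) m) := rfl

lemma homEv_homPresheafMap (α : M ⟶ M') {X : Over B} (y : (homPresheaf I M').obj (op X))
    (V : Cᵒᵖ) (m : M.obj (atStage X V)) :
    homEv ((homPresheafMap I α).app (op X) y) V m = homEv y V (α.app _ m) := rfl

end HomPresheaf

namespace Shape

variable (W : Shape B)

/-- The free algebra that carries the universal decorated tuple with a given decoration. -/
noncomputable abbrev genAlg {V : Cᵒᵖ} (γ : Σ i, W.N i V) : Over B := freeOver V (W.β γ.1 γ.2)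

/-- The universal decorated tuple with a given decoration. -/
noncomputable def gen {V : Cᵒᵖ} (γ : Σ i, W.N i V) : El W (atStage (W.genAlg γ) V) :=
  ⟨γ.1, γ.2, fun j => freeOverGen _ j, fun j => augMap_freeOverGen _ j⟩

variable {W}

/-- The decoration of a decorated tuple. -/
abbrev El.deco {X : Over B} {V : Cᵒᵖ} (w : El W (atStage X V)) : Σ i, W.N i V := ⟨w.i, w.ν⟩

lemma El.map_atMap {Y X : Over B} {V : Cᵒᵖ} (f : Y ⟶ X) {i : W.ι} (ν : W.N i V)
    (q : Fin (W.n i) → Sec Y V) (hq) (h) :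
    (El.mk (W := W) (Q := atStage Y V) i ν q hq).map (atMap f V) =
      ⟨i, ν, fun j => secMap f V (q j), h⟩ :=
  El.ext' (W.res_id _ _) rfl

/-- Existence half of the bijection between decorated tuples of `X` over `V` and pairs of a
decoration `γ` and a morphism `W.genAlg γ ⟶ X`. Uniqueness is `sigma_eq_of_gen_map_eq`. -/
lemma exists_gen_map {X : Over B} {V : Cᵒᵖ} (w : El W (atStage X V)) :
    ∃ φ : W.genAlg w.deco ⟶ X, (W.gen w.deco).map (atMap φ V) = w := by
  obtain ⟨φ, hφ⟩ := exists_freeOver_hom (W.β w.i w.ν) X w.q w.aug_q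
  exact ⟨φ, (El.map_atMap φ _ _ _ fun j =>
    (congrArg (augMap X V) (hφ j)).trans (w.aug_q j)).trans (El.ext' rfl (funext hφ))⟩

lemma gen_map_atMap {X : Over B} {V : Cᵒᵖ} {γ : Σ i, W.N i V} (f : W.genAlg γ ⟶ X) :
    (W.gen γ).map (atMap f V) = ⟨γ.1, γ.2, fun j => secMap f V (freeOverGen (W.β γ.1 γ.2) j),
      fun j => (augMap_secMap _ _ _).trans (augMap_freeOverGen _ j)⟩ :=
  El.map_atMap f _ _ _ _

lemma sigma_eq_of_gen_map_eq {X : Over B} {V : Cᵒᵖ} {γ γ' : Σ i, W.N i V} {f : W.genAlg γ ⟶ X}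
    {f' : W.genAlg γ' ⟶ X}
    (h : (W.gen γ).map (atMap f V) = (W.gen γ').map (atMap f' V)) :
    (⟨γ, f⟩ : Σ γ : (Σ i, W.N i V), W.genAlg γ ⟶ X) = ⟨γ', f'⟩ := by
  rw [gen_map_atMap, gen_map_atMap] at h
  obtain ⟨i, ν⟩ := γ
  obtain ⟨i', ν'⟩ := γ'
  obtain ⟨rfl, hν, hq⟩ := El.mk.inj h
  obtain rfl := eq_of_heq hν
  congr 1
  exact freeOver_hom_ext fun j => congrFun (eq_of_heq hq) j

/-- The morphism that sends the universal decorated tuple to a given one. -/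
noncomputable def El.classify {X : Over B} {V : Cᵒᵖ} (w : El W (atStage X V)) :
    W.genAlg w.deco ⟶ X := (exists_gen_map w).choose

lemma El.gen_map_classify {X : Over B} {V : Cᵒᵖ} (w : El W (atStage X V)) :
    (W.gen w.deco).map (atMap w.classify V) = w := (exists_gen_map w).choose_spec

/-! ### The left adjoint of `I ↦ homPresheaf I W.free` -/

section Transpose

open scoped Classical DirectSum

variable (N : (Over B)ᵒᵖ ⥤ AddCommGrpCat.{u + 1})

/-- The group of formal sums of decorated tuples with coefficients in an abelian presheaf. -/
abbrev Tw (W : Shape B) (V : Cᵒᵖ) : Type (u + 1) :=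
  ⨁ γ : (Σ i, W.N i V), N.obj (op (W.genAlg γ))

/-- The formal multiple of a decorated tuple. -/
noncomputable def tw {X : Over B} {V : Cᵒᵖ} (w : El W (atStage X V)) :
    N.obj (op X) →+ Tw N W V :=
  (DirectSum.of (fun γ : (Σ i, W.N i V) => N.obj (op (W.genAlg γ))) w.deco).comp
    (N.map w.classify.op).hom

/-- A morphism carrying the universal tuple to a given one is unique, so the choice made in
`El.classify` is immaterial. -/
lemma tw_gen_map {X : Over B} {V : Cᵒᵖ} (γ : Σ i, W.N i V) (f : W.genAlg γ ⟶ X)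
    (x : N.obj (op X)) :
    tw N ((W.gen γ).map (atMap f V)) x =
      DirectSum.of (fun γ : (Σ i, W.N i V) => N.obj (op (W.genAlg γ))) γ (N.map f.op x) := by
  have h := sigma_eq_of_gen_map_eq ((W.gen γ).map (atMap f V)).gen_map_classify
  exact congrArg (fun p : Σ γ : (Σ i, W.N i V), W.genAlg γ ⟶ X => DirectSum.of
    (fun γ : (Σ i, W.N i V) => N.obj (op (W.genAlg γ))) p.1 (N.map p.2.op x)) h

/-- The coend relation: `Tw` is the tensor product over `Over B` of `N` with the free groups on
decorated tuples, written as a direct sum because the functor of decorated tuples over `V` is a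
disjoint union of representables. -/
lemma tw_map {Y X : Over B} {V : Cᵒᵖ} (f : Y ⟶ X) (w : El W (atStage Y V)) (x : N.obj (op X)) :
    tw N (w.map (atMap f V)) x = tw N w (N.map f.op x) := by
  conv_lhs => rw [← w.gen_map_classify, ← El.map_comp, ← atMap_comp, tw_gen_map]
  rw [op_comp, N.map_comp]
  rfl

/-- Restriction of formal sums. -/
noncomputable def twRes {U V : Cᵒᵖ} (g : U ⟶ V) : Tw N W U →+ Tw N W V :=
  DirectSum.toAddMonoid fun γ => tw N ((W.gen γ).map (atRes _ g))

lemma twRes_tw {U V : Cᵒᵖ} (g : U ⟶ V) {X : Over B} (w : El W (atStage X U)) (x : N.obj (op X)) :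
    twRes N g (tw N w x) = tw N (w.map (atRes X g)) x := by
  refine (DirectSum.toAddMonoid_of _ _ _).trans ?_
  refine (tw_map N _ _ x).symm.trans ?_
  rw [← El.map_comp, ← atMap_atRes, El.map_comp, w.gen_map_classify]

lemma of_eq_tw {V : Cᵒᵖ} (γ : Σ i, W.N i V) (x : N.obj (op (W.genAlg γ))) :
    DirectSum.of (fun γ : (Σ i, W.N i V) => N.obj (op (W.genAlg γ))) γ x = tw N (W.gen γ) x := by
  have := tw_gen_map N γ (𝟙 _) x
  rw [atMap_id, El.map_id, op_id, N.map_id] at this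
  exact this.symm

variable {N} in
lemma tw_hom_ext {V : Cᵒᵖ} {G : Type*} [AddCommGroup G] {f g : Tw N W V →+ G}
    (h : ∀ (X : Over B) (w : El W (atStage X V)) (x : N.obj (op X)),
      f (tw N w x) = g (tw N w x)) : f = g := by
  refine DirectSum.addHom_ext fun γ x => ?_
  rw [of_eq_tw, h]

variable (W) in
/-- The presheaf of formal sums of decorated tuples with coefficients in an abelian presheaf. -/
noncomputable def twPresheaf : Cᵒᵖ ⥤ AddCommGrpCat.{u + 1} where
  obj V := AddCommGrpCat.of (Tw N W V)
  map g := AddCommGrpCat.ofHom (twRes N g)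
  map_id V := AddCommGrpCat.hom_ext (tw_hom_ext fun X w x => by
    refine (twRes_tw N _ _ _).trans ?_
    rw [atRes_id, El.map_id]; rfl)
  map_comp f g := AddCommGrpCat.hom_ext (tw_hom_ext fun X w x => by
    refine (twRes_tw N _ _ _).trans ?_
    refine Eq.trans ?_ (congrArg (twRes N g) (twRes_tw N f w x)).symm
    rw [twRes_tw, atRes_comp, El.map_comp])

variable {N} {N' : (Over B)ᵒᵖ ⥤ AddCommGrpCat.{u + 1}}

/-- Functoriality of formal sums in the coefficients. -/
noncomputable def twMap (f : N' ⟶ N) (V : Cᵒᵖ) : Tw N' W V →+ Tw N W V :=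
  DirectSum.map fun γ => (f.app (op (W.genAlg γ))).hom

lemma twMap_tw (f : N' ⟶ N) {V : Cᵒᵖ} {X : Over B} (w : El W (atStage X V)) (x : N'.obj (op X)) :
    twMap f V (tw N' w x) = tw N w (f.app (op X) x) := by
  refine (DirectSum.map_of _ _ _).trans ?_
  exact congrArg _ congr($(f.naturality w.classify.op) x)

variable (W) in
/-- Functoriality of `twPresheaf`. -/
noncomputable def twPresheafMap (f : N' ⟶ N) : W.twPresheaf N' ⟶ W.twPresheaf N where
  app V := AddCommGrpCat.ofHom (twMap f V)
  naturality U V g := AddCommGrpCat.hom_ext (tw_hom_ext fun X w x => by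
    change twMap f V (twRes N' g (tw N' w x)) = twRes N g (twMap f U (tw N' w x))
    rw [twRes_tw, twMap_tw, twMap_tw, twRes_tw])

/-- Over each object the functor is a direct sum of evaluations of the coefficients, and direct sums
preserve injections. -/
instance (f : N' ⟶ N) [Mono f] : Mono (W.twPresheafMap f) := by
  rw [NatTrans.mono_iff_mono_app]
  intro V
  rw [AddCommGrpCat.mono_iff_injective]
  refine (DirectSum.map_injective _).2 fun γ => ?_
  have : Mono (f.app (op (W.genAlg γ))) := inferInstance
  exact (AddCommGrpCat.mono_iff_injective _).1 this

variable {I : Cᵒᵖ ⥤ AddCommGrpCat.{u + 1}}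

/-- The morphism of presheaves on the site that corresponds to a morphism to `homPresheaf`. -/
noncomputable def twTranspose (a : N ⟶ homPresheaf I W.free) : W.twPresheaf N ⟶ I :=
  have key : ∀ (V : Cᵒᵖ) (X : Over B) (w : El W (atStage X V)) (x : N.obj (op X)),
      DirectSum.toAddMonoid (fun γ => AddMonoidHom.mk'
        (fun x => homEv (a.app (op (W.genAlg γ)) x) V (W.of (W.gen γ)))
          (fun x y => by rw [map_add]; rfl)) (tw N w x) = homEv (a.app (op X) x) V (W.of w) := by
    intro V X w x
    refine (DirectSum.toAddMonoid_of _ _ _).trans ?_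
    refine (congr(homEv ($(a.naturality w.classify.op) x) V (W.of (W.gen w.deco)))).trans ?_
    refine (homEv_map _ _ _ _).trans ?_
    rw [free_map_of, w.gen_map_classify]
    rfl
  { app V := AddCommGrpCat.ofHom (DirectSum.toAddMonoid fun γ => AddMonoidHom.mk'
        (fun x => homEv (a.app (op (W.genAlg γ)) x) V (W.of (W.gen γ)))
          (fun x y => by rw [map_add]; rfl))
    naturality U V g := AddCommGrpCat.hom_ext (tw_hom_ext fun X w x => by
      refine (congrArg _ (twRes_tw N g w x)).trans ((key V X _ x).trans ?_)
      refine Eq.trans ?_ (congrArg (I.map g) (key U X w x)).symm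
      rw [← free_map_of, homEv_res]) }

lemma twTranspose_tw (a : N ⟶ homPresheaf I W.free) {V : Cᵒᵖ} {X : Over B}
    (w : El W (atStage X V)) (x : N.obj (op X)) :
    (twTranspose a).app V (tw N w x) = homEv (a.app (op X) x) V (W.of w) := by
  refine (DirectSum.toAddMonoid_of _ _ _).trans ?_
  refine (congr(homEv ($(a.naturality w.classify.op) x) V (W.of (W.gen w.deco)))).trans ?_
  refine (homEv_map _ _ _ _).trans ?_
  rw [free_map_of, w.gen_map_classify]
  rfl

lemma free_addHom_ext {Q : Stage B} {G : Type*} [AddCommGroup G] {f g : W.free.obj Q →+ G}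
    (h : ∀ w, f (W.of w) = g (W.of w)) : f = g :=
  FreeAbelianGroup.lift_ext _ _ h

/-- A section of `homPresheaf I W.free` from its values on decorated tuples. -/
def homFree {X : Over B} (φ : ∀ V, El W (atStage X V) → I.obj V)
    (hφ : ∀ {U V : Cᵒᵖ} (g : U ⟶ V) (w : El W (atStage X U)),
      φ V (w.map (atRes X g)) = I.map g (φ U w)) : (homPresheaf I W.free).obj (op X) :=
  homMk (fun V => FreeAbelianGroup.lift (φ V)) (fun {U V} g m => by
    refine DFunLike.congr_fun (free_addHom_ext (W := W)
      (f := (FreeAbelianGroup.lift (φ V)).comp (W.free.map (atRes X g)).hom)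
      (g := (I.map g).hom.comp (FreeAbelianGroup.lift (φ U))) fun w => ?_) m
    change FreeAbelianGroup.lift (φ V) (W.free.map (atRes X g) (W.of w)) =
      I.map g (FreeAbelianGroup.lift (φ U) (W.of w))
    rw [free_map_of]
    simp only [of, FreeAbelianGroup.lift_apply_of, hφ])

lemma homEv_homFree {X : Over B} (φ : ∀ V, El W (atStage X V) → I.obj V)
    (hφ : ∀ {U V : Cᵒᵖ} (g : U ⟶ V) (w : El W (atStage X U)),
      φ V (w.map (atRes X g)) = I.map g (φ U w)) (V : Cᵒᵖ) (w : El W (atStage X V)) :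
    homEv (homFree φ hφ) V (W.of w) = φ V w :=
  FreeAbelianGroup.lift_apply_of _ _

lemma homFree_ext {X : Over B} {y z : (homPresheaf I W.free).obj (op X)}
    (h : ∀ V w, homEv y V (W.of w) = homEv z V (W.of w)) : y = z :=
  homEv_ext fun V m => DFunLike.congr_fun (free_addHom_ext (h V)) m

/-- The section of `homPresheaf` obtained by pairing with a section of an abelian presheaf. -/
noncomputable def pair (b : W.twPresheaf N ⟶ I) {X : Over B} (x : N.obj (op X)) :
    (homPresheaf I W.free).obj (op X) :=
  homFree (fun V w => b.app V (tw N w x)) (fun {U V} g w => by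
    rw [← twRes_tw]
    exact congr($(b.naturality g) (tw N w x)))

lemma homEv_pair (b : W.twPresheaf N ⟶ I) {X : Over B} (x : N.obj (op X)) (V : Cᵒᵖ)
    (w : El W (atStage X V)) : homEv (pair b x) V (W.of w) = b.app V (tw N w x) :=
  FreeAbelianGroup.lift_apply_of _ _

/-- The morphism to `homPresheaf` that corresponds to a morphism of presheaves on the site. -/
noncomputable def twUntranspose (b : W.twPresheaf N ⟶ I) : N ⟶ homPresheaf I W.free where
  app X := AddCommGrpCat.ofHom (AddMonoidHom.mk' (fun x => pair (X := X.unop) b x)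
    (fun x y => homFree_ext (X := X.unop) fun V w => by
      refine (homEv_pair (X := X.unop) b (x + y) V w).trans ?_
      refine Eq.trans ?_ (homEv_add (X := X.unop) _ _ V (W.of w)).symm
      refine Eq.trans ?_ congr($((homEv_pair (X := X.unop) b x V w).symm) +
        $((homEv_pair (X := X.unop) b y V w).symm))
      exact (congrArg (b.app V) (map_add (tw N w) x y)).trans (map_add (b.app V).hom _ _)))
  naturality X Y f := by
    ext x
    refine homFree_ext (X := Y.unop) fun V w => ?_
    refine (homEv_pair (X := Y.unop) b (N.map f x) V w).trans ?_
    refine Eq.trans ?_ (homEv_map f.unop (pair (X := X.unop) b x) V (W.of w)).symm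
    rw [free_map_of]
    refine Eq.trans ?_ (homEv_pair (X := X.unop) b x V _).symm
    exact congrArg (b.app V) (tw_map N f.unop w x).symm

end Transpose

/-- A right adjoint of a functor preserving monomorphisms preserves injectives: transpose, extend
into `I`, and transpose back. -/
instance injective_homPresheaf_free (I : Cᵒᵖ ⥤ AddCommGrpCat.{u + 1}) [Injective I] :
    Injective (homPresheaf I W.free) where
  factors {N' N} a f _ := by
    let b := Injective.factorThru (twTranspose a) (W.twPresheafMap f)
    have hb : W.twPresheafMap f ≫ b = twTranspose a := Injective.comp_factorThru _ _
    refine ⟨twUntranspose b, ?_⟩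
    ext X x
    refine homFree_ext (X := X.unop) fun V w => ?_
    refine (homEv_pair (X := X.unop) b (f.app X x) V w).trans ?_
    refine (congrArg (b.app V) (twMap_tw (X := X.unop) f w x).symm).trans ?_
    exact (congr(($hb).app V (tw (X := X.unop) N' w x))).trans (twTranspose_tw (X := X.unop) a w x)

end Shape

end TopAlg

/-! ### The presheaf of homomorphisms is a sheaf -/

namespace TopAlg

variable {C : Type u} [SmallCategory C] {K : GrothendieckTopology C}
variable {A : Sheaf K CommRingCat.{u}} {B : Under A}

section SheafElements

variable {I : Cᵒᵖ ⥤ AddCommGrpCat.{u + 1}}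

lemma eq_of_cover (hI : Presieve.IsSheaf K (I ⋙ forget AddCommGrpCat)) {U : C} {T : Sieve U}
    (hT : T ∈ K U) {m n : I.obj (op U)}
    (h : ∀ ⦃V : C⦄ (g : V ⟶ U), T g → I.map g.op m = I.map g.op n) : m = n :=
  (hI T hT).isSeparatedFor.ext h

lemma exists_glue_of_cover (hI : Presieve.IsSheaf K (I ⋙ forget AddCommGrpCat)) {U : C}
    {T : Sieve U} (hT : T ∈ K U) (x : ∀ ⦃V : C⦄ (g : V ⟶ U), T g → I.obj (op V))
    (hx : ∀ ⦃V W : C⦄ (g : V ⟶ U) (hg : T g) (k : W ⟶ V),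
      I.map k.op (x g hg) = x (k ≫ g) (T.downward_closed hg k)) :
    ∃ m : I.obj (op U), ∀ ⦃V : C⦄ (g : V ⟶ U) (hg : T g), I.map g.op m = x g hg := by
  have hc : Presieve.FamilyOfElements.Compatible
      (P := I ⋙ forget AddCommGrpCat) (R := T.arrows) x := by
    refine (Presieve.compatible_iff_sieveCompatible _).2 ?_
    intro V W g k hg
    exact (hx g hg k).symm
  exact ⟨_, fun V g hg => (hI T hT).valid_glue hc g hg⟩

end SheafElements

namespace Shape

variable {W : Shape B}

/-- A tuple has finitely many entries, so the topology lifts them all to one member of the sieve;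
the decoration needs no lifting, as it lives on the small site. -/
lemma El.exists_lift {X : Over B} {R : Sieve X} (hR : R ∈ liftTopology B X) {U : C}
    (w : El W (atStage X (op U))) : ∃ T ∈ K U, ∀ ⦃V : C⦄ (g : V ⟶ U), T g →
      ∃ (Y : Over B) (f : Y ⟶ X) (_ : R f) (w' : El W (atStage Y (op V))),
        w'.map (atMap f (op V)) = w.map (atRes X g.op) := by
  classical
  refine ⟨_, hR U (Finset.univ.image w.q), ?_⟩
  rintro V g ⟨Y, f, hf, h⟩
  choose y hy using fun j => h (w.q j) (Finset.mem_image_of_mem _ (Finset.mem_univ j))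
  have hy' : ∀ j, augMap Y (op V) (y j) = W.β w.i (W.res _ g.op w.ν) j := fun j => by
    rw [← augMap_secMap f, hy]
    exact ((w.map (atRes X g.op)).aug_q j)
  exact ⟨Y, f, hf, ⟨w.i, W.res _ g.op w.ν, y, hy'⟩, El.ext' (W.res_id _ _) (funext hy)⟩

variable {I : Cᵒᵖ ⥤ AddCommGrpCat.{u + 1}}

/-! ### Gluing the values on a decorated tuple -/

section Glue

variable {X : Over B} {R : Sieve X}
  (x : ∀ ⦃Y : Over B⦄ (f : Y ⟶ X), R f → (homPresheaf I W.free).obj (op Y))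

/-- Both tuples are classified by the same morphism from a free algebra to `X`, and this morphism
belongs to `R`. Compatibility of `x` expresses both values through its member at that morphism. -/
lemma homEv_eq_of_map_eq
    (hx : ∀ ⦃Y Z : Over B⦄ (f : Y ⟶ X) (hf : R f) (k : Z ⟶ Y),
      (homPresheaf I W.free).map k.op (x f hf) = x (k ≫ f) (R.downward_closed hf k))
    {V : Cᵒᵖ} {Y Y' : Over B} {f : Y ⟶ X} {f' : Y' ⟶ X} (hf : R f)
    (hf' : R f') {w : El W (atStage Y V)} {w' : El W (atStage Y' V)}
    (h : w.map (atMap f V) = w'.map (atMap f' V)) :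
    homEv (x f hf) V (W.of w) = homEv (x f' hf') V (W.of w') := by
  have key : ∀ {Y : Over B} {f : Y ⟶ X} (hf : R f) (w : El W (atStage Y V)),
      homEv (x f hf) V (W.of w) = homEv (x (w.classify ≫ f) (R.downward_closed hf _)) V
        (W.of (W.gen w.deco)) := by
    intro Y f hf w
    rw [← hx, homEv_map, free_map_of, w.gen_map_classify]
  have key' : ∀ (p p' : Σ γ : (Σ i, W.N i V), W.genAlg γ ⟶ X) (hp : R p.2) (hp' : R p'.2),
      p = p' → homEv (x p.2 hp) V (W.of (W.gen p.1)) =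
        homEv (x p'.2 hp') V (W.of (W.gen p'.1)) := by
    rintro p p' hp hp' rfl
    rfl
  rw [key hf w, key hf' w']
  refine key' ⟨_, _⟩ ⟨_, _⟩ _ _ (sigma_eq_of_gen_map_eq ?_)
  rw [atMap_comp, atMap_comp, El.map_comp, El.map_comp, w.gen_map_classify, w'.gen_map_classify, h]

/-- The lifts of the tuple prescribe local values, compatible by `homEv_eq_of_map_eq`; they glue
because `I` is a sheaf. -/
lemma exists_glue_value
    (hx : ∀ ⦃Y Z : Over B⦄ (f : Y ⟶ X) (hf : R f) (k : Z ⟶ Y),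
      (homPresheaf I W.free).map k.op (x f hf) = x (k ≫ f) (R.downward_closed hf k))
    (hI : Presieve.IsSheaf K (I ⋙ forget AddCommGrpCat))
    (hR : R ∈ liftTopology B X) {U : C} (w : El W (atStage X (op U))) :
    ∃ m : I.obj (op U), ∀ ⦃V : C⦄ (g : V ⟶ U) ⦃Y : Over B⦄ (f : Y ⟶ X) (hf : R f)
      (w' : El W (atStage Y (op V))), w'.map (atMap f (op V)) = w.map (atRes X g.op) →
        I.map g.op m = homEv (x f hf) (op V) (W.of w') := by
  obtain ⟨T, hT, h⟩ := w.exists_lift hR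
  choose Y f hf w' hw' using h
  have compat : ∀ ⦃V V' : C⦄ (g : V ⟶ U) (hg : T g) (k : V' ⟶ V) ⦃Z : Over B⦄ (e : Z ⟶ X)
      (he : R e) (z : El W (atStage Z (op V'))),
      z.map (atMap e (op V')) = w.map (atRes X (k ≫ g).op) →
      I.map k.op (homEv (x (f g hg) (hf g hg)) (op V) (W.of (w' g hg))) =
        homEv (x e he) (op V') (W.of z) := by
    intro V V' g hg k Z e he z hz
    rw [← homEv_res, free_map_of]
    refine homEv_eq_of_map_eq x hx _ _ ?_
    rw [hz, ← El.map_comp, ← atMap_atRes, El.map_comp, hw', ← El.map_comp, ← atRes_comp, op_comp]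
  obtain ⟨m, hm⟩ := exists_glue_of_cover hI hT
    (fun V g hg => homEv (x (f g hg) (hf g hg)) (op V) (W.of (w' g hg)))
    (fun V V' g hg k => compat g hg k _ _ _ (hw' _ _))
  refine ⟨m, fun V g Z e he z hz => ?_⟩
  refine eq_of_cover hI (K.pullback_stable g hT) fun V' k hk => ?_
  rw [← AddCommGrpCat.comp_apply, ← I.map_comp, ← op_comp, hm _ hk, ← homEv_res, free_map_of]
  refine homEv_eq_of_map_eq x hx _ _ ?_
  refine (hw' (k ≫ g) hk).trans ?_
  rw [← El.map_comp, ← atMap_atRes, El.map_comp, hz, ← El.map_comp, ← atRes_comp, op_comp]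

end Glue

lemma homFree_eq_of_cover (hI : Presieve.IsSheaf K (I ⋙ forget AddCommGrpCat)) {X : Over B}
    {R : Sieve X} (hR : R ∈ liftTopology B X) {y z : (homPresheaf I W.free).obj (op X)}
    (h : ∀ ⦃Y : Over B⦄ (f : Y ⟶ X), R f →
      (homPresheaf I W.free).map f.op y = (homPresheaf I W.free).map f.op z) : y = z := by
  refine homFree_ext fun U w => ?_
  obtain ⟨T, hT, hl⟩ := El.exists_lift (U := U.unop) hR w
  refine eq_of_cover hI hT fun V g hg => ?_
  obtain ⟨Y, f, hf, w', hw'⟩ := hl g hg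
  have key : ∀ y : (homPresheaf I W.free).obj (op X), I.map g.op (homEv y U (W.of w)) =
      homEv ((homPresheaf I W.free).map f.op y) (op V) (W.of w') := fun y => by
    rw [homEv_map, free_map_of, hw', ← free_map_of, homEv_res]
  exact (key y).trans ((congrArg (fun d => homEv d (op V) (W.of w')) (h f hf)).trans (key z).symm)

lemma isSheaf_homPresheaf_free (hI : Presieve.IsSheaf K (I ⋙ forget AddCommGrpCat)) :
    Presheaf.IsSheaf (liftTopology B) (homPresheaf I W.free) := by
  rw [Presheaf.isSheaf_iff_isSheaf_forget.{u, u + 1, _} _ _ (forget AddCommGrpCat.{u + 1}),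
    isSheaf_iff_isSheaf_of_type]
  intro X R hR
  refine Presieve.isSeparatedFor_and_exists_isAmalgamation_iff_isSheafFor.1 ⟨?_, ?_⟩
  · intro x d e hd he
    exact homFree_eq_of_cover hI hR fun Y f hf => (hd f hf).trans (he f hf).symm
  · intro x hx
    have hx' : ∀ ⦃Y Z : Over B⦄ (f : Y ⟶ X) (hf : R f) (k : Z ⟶ Y),
        (homPresheaf I W.free).map k.op (x f hf) = x (k ≫ f) (R.downward_closed hf k) :=
      fun Y Z f hf k => (((Presieve.compatible_iff_sieveCompatible _).1 hx) f k hf).symm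
    choose m hm using fun U w => exists_glue_value (U := U) (W := W) x hx' hI hR w
    refine ⟨homFree (fun V w => m V.unop w) ?_, ?_⟩
    · intro U V g w
      obtain ⟨T, hT, hl⟩ := El.exists_lift (U := V.unop) hR (w.map (atRes X g))
      refine eq_of_cover hI hT fun V' k hk => ?_
      obtain ⟨Y, f, hf, w', hw'⟩ := hl k hk
      refine (hm V.unop _ k f hf w' hw').trans ?_
      refine (hm U.unop w (k ≫ g.unop) f hf w' ?_).symm.trans ?_
      · rw [hw', ← El.map_comp, ← atRes_comp]
        rfl
      · exact congr($(I.map_comp g k.op) (m U.unop w))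
    · intro Y f hf
      refine homFree_ext fun V w => ?_
      refine (homEv_map f _ V (W.of w)).trans ?_
      rw [free_map_of, homEv_homFree]
      have := hm V.unop (w.map (atMap f V)) (𝟙 _) f hf w (by
        rw [op_id, atRes_id]; exact (El.map_id _).symm)
      rw [op_id, I.map_id] at this
      exact this

end Shape

end TopAlg

/-! ### Locally ind-polynomial algebras -/

namespace TopAlg

variable {C : Type u} [SmallCategory C] {K : GrothendieckTopology C}

section Injective

/-- The inclusion of sheaves in presheaves is right adjoint to the exact sheafification functor. -/
instance injective_obj (I : Sheaf K AddCommGrpCat.{u}) [Injective I] : Injective I.obj :=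
  Injective.injective_of_adjoint (sheafificationAdjunction K AddCommGrpCat.{u}) I

lemma isSheaf_comp_uliftFunctor (I : Sheaf K AddCommGrpCat.{u}) :
    Presieve.IsSheaf K
      ((I.obj ⋙ AddCommGrpCat.uliftFunctor.{u + 1, u}) ⋙ forget AddCommGrpCat.{u + 1}) := by
  have h := (isSheaf_iff_isSheaf_of_type _ _).1
    ((Presheaf.isSheaf_iff_isSheaf_forget K _ (forget AddCommGrpCat.{u})).1 I.property)
  intro U T hT
  refine Presieve.isSeparatedFor_and_exists_isAmalgamation_iff_isSheafFor.1 ⟨?_, ?_⟩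
  · intro x d e hd he
    exact ULift.ext _ _ ((h T hT).isSeparatedFor.ext fun V g hg =>
      congrArg ULift.down ((hd g hg).trans (he g hg).symm))
  · intro x hx
    have hc : Presieve.FamilyOfElements.Compatible (P := I.obj ⋙ forget AddCommGrpCat)
        (R := T.arrows) (fun V g hg => (x g hg).down) := by
      refine (Presieve.compatible_iff_sieveCompatible _).2 fun V W g k hg => ?_
      exact congrArg ULift.down (((Presieve.compatible_iff_sieveCompatible _).1 hx) g k hg)
    exact ⟨ULift.up ((h T hT).amalgamate _ hc), fun V g hg =>
      ULift.ext _ _ ((h T hT).valid_glue hc g hg)⟩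

/-- A monomorphism of sheaves is one of presheaves, so the extension can be made among presheaves.
-/
lemma injective_sheaf_mk {D : Type*} [Category D] {τ : GrothendieckTopology D} {𝒜 : Type*}
    [Category 𝒜] [HasPullbacks 𝒜] {F : Dᵒᵖ ⥤ 𝒜} (hF : Presheaf.IsSheaf τ F) [Injective F] :
    Injective (⟨F, hF⟩ : Sheaf τ 𝒜) where
  factors {X Y} g f _ := by
    have : Mono f.hom := inferInstanceAs (Mono ((sheafToPresheaf τ 𝒜).map f))
    exact ⟨⟨Injective.factorThru (J := F) g.hom f.hom⟩, Sheaf.hom_ext (Injective.comp_factorThru _ _)⟩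

end Injective

variable {A : Sheaf K CommRingCat.{u}} {B : Under A}

lemma exists_cover_forall {U : C} {n : ℕ} {p : Fin n → ∀ V, (V ⟶ U) → Prop}
    (h : ∀ j, ∃ T ∈ K U, ∀ V (g : V ⟶ U), T g → p j V g) :
    ∃ T ∈ K U, ∀ V (g : V ⟶ U), T g → ∀ j, p j V g := by
  induction n with
  | zero => exact ⟨⊤, K.top_mem U, fun V g _ j => j.elim0⟩
  | succ n ih =>
    obtain ⟨T, hT, h₁⟩ := ih (fun j => h j.succ)
    obtain ⟨T', hT', h₂⟩ := h 0
    exact ⟨T ⊓ T', K.intersection_covering hT hT', fun V g hg j =>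
      Fin.cases (h₂ V g hg.2) (h₁ V g hg.1) j⟩

variable (B) in
/-- A finite tuple of sections of `B`, indexing a polynomial stage. -/
structure Tuple where
  /-- the object of the site -/
  base : Cᵒᵖ
  /-- the length -/
  n : ℕ
  /-- the sections -/
  b : Fin n → B.right.obj.obj base

/-- The polynomial stage of a tuple. -/
noncomputable abbrev Tuple.stage (P : Tuple B) : Stage B := Stage.poly P.base P.b

/-- An algebra over `B` is locally ind-polynomial if relations that hold in its sections
already hold, locally, in a polynomial algebra that maps to it. -/
def LocallyIndPoly (X : Over B) : Prop :=
  ∀ (P₁ P₂ : Tuple B) (k₁ k₂ : P₁.stage ⟶ P₂.stage) (U : C) (h : P₂.stage ⟶ atStage X (op U)),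
    k₁ ≫ h = k₂ ≫ h → ∃ T ∈ K U, ∀ (V : C) (g : V ⟶ U), T g →
      ∃ (P : Tuple B) (k : P₂.stage ⟶ P.stage) (h' : P.stage ⟶ atStage X (op V)),
        k ≫ h' = h ≫ atRes X g.op ∧ k₁ ≫ k = k₂ ≫ k

/-! ### Free algebras are locally ind-polynomial -/

section FreeAlgebra

variable {S : Cᵒᵖ ⥤ Type u} (f : freeAlgOn A S ⟶ B)

/-- The polynomial algebra on the sections of `S`, as a stage. -/
noncomputable def freeStage (V : Cᵒᵖ) : Stage B where
  base := V
  ring := (polyPresheafOn A S).obj V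
  str := (MvPolynomial.C : _ →+* MvPolynomial (S.obj V) (A.obj.obj V))
  aug := (augMap (Over.mk f) V).comp ((toSheafify K (polyPresheafOn A S)).app V).hom
  comm a := augMap_structMap (Over.mk f) V a

/-- The map from polynomials to sections of the free algebra. -/
noncomputable def freeStageMap (V : Cᵒᵖ) : freeStage f V ⟶ atStage (Over.mk f) V where
  base := 𝟙 V
  map := ((toSheafify K (polyPresheafOn A S)).app V).hom
  str_comm a := congrArg (structMap (Over.mk f) V) congr($(A.obj.map_id V) a).symm
  aug_comm _ := (bres_id _ _).symm

/-- Restriction of polynomials. -/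
noncomputable def freeStageRes {U V : Cᵒᵖ} (g : U ⟶ V) : freeStage f U ⟶ freeStage f V where
  base := g
  map := ((polyPresheafOn A S).map g).hom
  str_comm a := MvPolynomial.eval₂_C _ _ _
  aug_comm x := by
    refine Eq.trans ?_ (augMap_res (Over.mk f) g _)
    exact congrArg (augMap (Over.mk f) V) congr($((toSheafify K (polyPresheafOn A S)).naturality g) x)

lemma freeStageMap_res {U V : Cᵒᵖ} (g : U ⟶ V) :
    freeStageRes f g ≫ freeStageMap f V = freeStageMap f U ≫ atRes (Over.mk f) g :=
  Stage.hom_ext ((Category.comp_id g).trans (Category.id_comp g).symm) fun x =>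
    congr($((toSheafify K (polyPresheafOn A S)).naturality g) x)

/-- A presheaf maps locally surjectively to its sheafification, and only the images of finitely many
variables have to be lifted. -/
lemma exists_lift_freeStage {P : Tuple B} {U : C} (h : P.stage ⟶ atStage (Over.mk f) (op U)) :
    ∃ T ∈ K U, ∀ (V : C) (g : V ⟶ U), T g →
      ∃ h' : P.stage ⟶ freeStage f (op V), h' ≫ freeStageMap f _ = h ≫ atRes _ g.op := by
  obtain ⟨T, hT, hl⟩ := exists_cover_forall (K := K) (U := U)
    (p := fun j V g => ∃ x : (polyPresheafOn A S).obj (op V),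
      (toSheafify K (polyPresheafOn A S)).app _ x = res (Over.mk f) g.op (h.map (Stage.var P.b j)))
    fun j => ⟨_, Presheaf.imageSieve_mem K (toSheafify K (polyPresheafOn A S)) _, fun V g hg => hg⟩
  refine ⟨T, hT, fun V g hg => ?_⟩
  choose q hq using hl V g hg
  refine ⟨Stage.polyDesc (Q := freeStage f (op V)) (h.base ≫ g.op) q fun j => ?_, ?_⟩
  · refine (congrArg (augMap (Over.mk f) (op V)) (hq j)).trans ?_
    refine (augMap_res _ _ _).trans ?_
    refine (congrArg (bres B g.op) ((h.aug_comm _).trans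
      (congrArg _ (Stage.aug_var P.b j)))).trans ?_
    exact (bres_comp _ _ _).symm
  · refine Stage.poly_hom_ext (Category.comp_id _) fun j => ?_
    refine (congrArg (freeStageMap f (op V)).map (Stage.polyDesc_var _ _ _ _)).trans ?_
    exact hq j

/-- A presheaf maps locally injectively to its sheafification, and equality is tested on finitely
many variables. -/
lemma eq_locally_freeStage {P : Tuple B} {U : C} (k₁ k₂ : P.stage ⟶ freeStage f (op U))
    (e : k₁ ≫ freeStageMap f _ = k₂ ≫ freeStageMap f _) :
    ∃ T ∈ K U, ∀ (V : C) (g : V ⟶ U), T g →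
      k₁ ≫ freeStageRes f g.op = k₂ ≫ freeStageRes f g.op := by
  obtain ⟨T, hT, hl⟩ := exists_cover_forall (K := K) (U := U)
    (p := fun j V g => (polyPresheafOn A S).map g.op (k₁.map (Stage.var P.b j)) =
      (polyPresheafOn A S).map g.op (k₂.map (Stage.var P.b j)))
    fun j => ⟨_, Presheaf.equalizerSieve_mem K (toSheafify K (polyPresheafOn A S)) _ _
      (congr(Stage.Hom.map $e (Stage.var P.b j))), fun V g hg => hg⟩
  refine ⟨T, hT, fun V g hg => Stage.poly_hom_ext ?_ fun j => hl V g hg j⟩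
  have := congr(Stage.Hom.base $e)
  have hb : k₁.base = k₂.base := by
    refine (Category.comp_id _).symm.trans (this.trans (Category.comp_id _))
  exact congrArg (· ≫ g.op) hb

/-- Finitely many polynomials involve a finite set of variables `s`. The polynomial ring on `s` is a
subring, so relations between maps can be cancelled along `m`. -/
lemma exists_factor_freeStage {P : Tuple B} {U : Cᵒᵖ} (h : P.stage ⟶ freeStage f U) :
    ∃ (P' : Tuple B) (k : P.stage ⟶ P'.stage) (m : P'.stage ⟶ freeStage f U), k ≫ m = h ∧ Mono m := by
  classical
  let q : Fin P.n → MvPolynomial (S.obj U) (A.obj.obj U) := fun j => h.map (Stage.var P.b j)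
  let s : Finset (S.obj U) := Finset.univ.biUnion fun j => (q j).vars
  let ι : Fin s.card → S.obj U := fun j => (s.equivFin.symm j).1
  have hι : Function.Injective ι := Subtype.val_injective.comp s.equivFin.symm.injective
  have hq : ∀ j, ∃ q', MvPolynomial.rename ι q' = q j := fun j =>
    MvPolynomial.exists_rename_eq_of_vars_subset_range _ _ hι fun x hx =>
      ⟨s.equivFin ⟨x, Finset.mem_biUnion.2 ⟨j, Finset.mem_univ _, hx⟩⟩, by simp [ι]⟩
  choose q' hq' using hq
  let P' : Tuple B := ⟨U, s.card, fun j => (freeStage f U).aug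
    (MvPolynomial.X (ι j) : MvPolynomial (S.obj U) (A.obj.obj U))⟩
  let m : P'.stage ⟶ freeStage f U :=
    Stage.polyDesc (𝟙 U) (fun j => (MvPolynomial.X (ι j) : MvPolynomial (S.obj U) (A.obj.obj U))) fun j =>
      (bres_id U _).symm
  have hm : ∀ x : MvPolynomial _ _, m.map x = MvPolynomial.rename ι x := by
    intro x
    refine congr($(MvPolynomial.ringHom_ext (f := m.map) (g := (MvPolynomial.rename ι).toRingHom)
      (fun a => ?_) (fun j => ?_)) x)
    · refine (MvPolynomial.eval₂_C _ _ _).trans ?_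
      refine Eq.trans ?_ (MvPolynomial.rename_C _ _).symm
      exact congrArg MvPolynomial.C congr($(A.obj.map_id U) a)
    · exact (MvPolynomial.eval₂_X _ _ _).trans (MvPolynomial.rename_X _ _).symm
  have haug : ∀ x, P'.stage.aug x = (freeStage f U).aug (m.map x) := fun x =>
    ((m.aug_comm x).trans (bres_id _ _)).symm
  refine ⟨P', Stage.polyDesc h.base q' fun j => ?_, m, ?_, ⟨fun {Q} a b hab => ?_⟩⟩
  · refine (haug _).trans ?_
    rw [hm, hq']
    exact (h.aug_comm _).trans (congrArg _ (Stage.aug_var P.b j))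
  · refine Stage.poly_hom_ext (Category.comp_id _) fun j => ?_
    refine (congrArg m.map (Stage.polyDesc_var _ _ _ _)).trans ?_
    rw [hm, hq']
  · refine Stage.hom_ext ?_ fun x => ?_
    · exact (Category.comp_id _).symm.trans (congr(Stage.Hom.base $hab).trans (Category.comp_id _))
    · refine MvPolynomial.rename_injective ι hι ?_
      exact (hm _).symm.trans (congr(Stage.Hom.map $hab x).trans (hm _))

lemma locallyIndPoly_freeAlgOn : LocallyIndPoly (Over.mk f) := by
  intro P₁ P₂ k₁ k₂ U h e
  obtain ⟨T, hT, hl⟩ := exists_lift_freeStage f h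
  choose h₁ hh₁ using hl
  have key : ∀ (V : C) (g : V ⟶ U) (hg : T g), ∃ T' ∈ K V, ∀ (V' : C) (g' : V' ⟶ V), T' g' →
      k₁ ≫ h₁ V g hg ≫ freeStageRes f g'.op = k₂ ≫ h₁ V g hg ≫ freeStageRes f g'.op := by
    intro V g hg
    obtain ⟨T', hT', hl⟩ := eq_locally_freeStage f (k₁ ≫ h₁ V g hg) (k₂ ≫ h₁ V g hg) (by
      rw [Category.assoc, Category.assoc, hh₁, reassoc_of% e])
    exact ⟨T', hT', fun V' g' hg' => by simpa only [Category.assoc] using hl V' g' hg'⟩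
  choose T' hT' hl using key
  refine ⟨Sieve.bind T.arrows fun V g hg => T' V g hg, K.bind_covering hT fun V g hg => hT' V g hg, ?_⟩
  rintro V' _ ⟨V, g', g, hg, hg', rfl⟩
  obtain ⟨P, k, m, hkm, hm⟩ := exists_factor_freeStage f (h₁ V g hg ≫ freeStageRes f g'.op)
  refine ⟨P, k, m ≫ freeStageMap f _, ?_, ?_⟩
  · rw [reassoc_of% hkm, freeStageMap_res, reassoc_of% (hh₁ V g hg), op_comp, atRes_comp]
  · rw [← cancel_mono m, Category.assoc, Category.assoc, hkm, hl V g hg V' g' hg']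

end FreeAlgebra

variable {τ : GrothendieckTopology (Over B)}

lemma exists_cover_locallyIndPoly (hτ : uniformLiftTopology B ≤ τ) (X : Over B) :
    ∃ (Y : Over B) (f : Y ⟶ X), LocallyIndPoly Y ∧
      Sieve.generate (Presieve.singleton f) ∈ τ X := by
  let S : Cᵒᵖ ⥤ Type u := X.left.right.obj ⋙ forget CommRingCat
  let π : freeAlgOn A S ⟶ X.left := freeAlgDesc (fun V s => s) (fun g s => rfl)
  refine ⟨Over.mk (π ≫ X.hom), Over.homMk π, locallyIndPoly_freeAlgOn _, hτ _ ?_⟩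
  intro U Λ
  refine ⟨_, Over.homMk π, ⟨_, 𝟙 _, _, ⟨⟩, Category.id_comp _⟩, U, 𝟙 U, inferInstance, fun x _ => ?_⟩
  -- The free algebra on the underlying presheaf of sets of `X` maps to `X` with a section of
  -- sheaves of sets, so all sections lift without refining `U`.
  let σ : (toSet B).obj X ⟶ (toSet B).obj (Over.mk (π ≫ X.hom)) :=
    ⟨{ app V := ↾fun s => freeAlgGen (S := S) V s
       naturality V V' g := by
        ext s
        exact (freeAlgGen_map (S := S) g s).symm }⟩
  have hσ : σ ≫ (toSet B).map (Over.homMk π : Over.mk (π ≫ X.hom) ⟶ X) = 𝟙 _ := by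
    apply Sheaf.hom_ext
    ext V s
    exact freeAlgDesc_gen (Y := X.left) (S := S) (fun V s => s) (fun g s => rfl) V s
  refine ⟨x ≫ σ, ?_⟩
  rw [Category.assoc, hσ, Category.comp_id, Category.id_comp]

end TopAlg

/-! ### Locally finitary functors on stages -/

namespace TopAlg

variable {C : Type u} [SmallCategory C] {K : GrothendieckTopology C}

lemma exists_cover_bind {U : C} {p q : ∀ V, (V ⟶ U) → Prop}
    (h : ∃ T ∈ K U, ∀ V (g : V ⟶ U), T g → p V g)
    (h' : ∀ V (g : V ⟶ U), p V g → ∃ T ∈ K V, ∀ V' (g' : V' ⟶ V), T g' → q V' (g' ≫ g)) :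
    ∃ T ∈ K U, ∀ V (g : V ⟶ U), T g → q V g := by
  obtain ⟨T, hT, hl⟩ := h
  choose T' hT' hl' using fun V (g : V ⟶ U) (hg : T g) => h' V g (hl V g hg)
  refine ⟨Sieve.bind T.arrows fun V g hg => T' V g hg,
    K.bind_covering hT fun V g hg => hT' V g hg, ?_⟩
  rintro V' _ ⟨V, g', g, hg, hg', rfl⟩
  exact hl' V g hg V' g' hg'

lemma exists_cover_self {U : C} {p : ∀ V, (V ⟶ U) → Prop} (h : ∀ V g, p V g) :
    ∃ T ∈ K U, ∀ V (g : V ⟶ U), T g → p V g :=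
  ⟨⊤, K.top_mem U, fun V g _ => h V g⟩

variable {A : Sheaf K CommRingCat.{u}} {B : Under A}

/-! ### Finite supports in free abelian groups -/

section FreeAbelian

universe v

lemma lift_eq_of_support {α : Type*} (m : FreeAbelianGroup α) :
    ∃ S : Finset α, ∀ (G : Type v) [AddCommGroup G] (φ ψ : α → G), (∀ a ∈ S, φ a = ψ a) →
      FreeAbelianGroup.lift φ m = FreeAbelianGroup.lift ψ m := by
  classical
  induction m using FreeAbelianGroup.induction_on with
  | zero => exact ⟨∅, fun G _ φ ψ _ => by simp⟩
  | of a => exact ⟨{a}, fun G _ φ ψ h => by simpa using h⟩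
  | neg a ih =>
    obtain ⟨S, hS⟩ := ih
    exact ⟨S, fun G _ φ ψ h => by rw [map_neg, map_neg, hS G φ ψ h]⟩
  | add x y hx hy =>
    obtain ⟨S, hS⟩ := hx
    obtain ⟨S', hS'⟩ := hy
    refine ⟨S ∪ S', fun G _ φ ψ h => ?_⟩
    rw [map_add, map_add, hS G φ ψ fun a ha => h a (Finset.mem_union_left _ ha),
      hS' G φ ψ fun a ha => h a (Finset.mem_union_right _ ha)]

/-- An element of a free abelian group that is killed by a map of the bases is killed by every
map that makes the same finitely many identifications. -/
lemma exists_pairs_of_map_eq_zero {α : Type*} {β : Type*} (h : α → β) (m : FreeAbelianGroup α)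
    (hm : FreeAbelianGroup.map h m = 0) :
    ∃ L : Finset (α × α), (∀ p ∈ L, h p.1 = h p.2) ∧
      ∀ (γ : Type v) (k : α → γ), (∀ p ∈ L, k p.1 = k p.2) → FreeAbelianGroup.map k m = 0 := by
  classical
  obtain ⟨S, hS⟩ := lift_eq_of_support.{v} m
  refine ⟨(S ×ˢ S).filter fun p => h p.1 = h p.2, fun p hp => (Finset.mem_filter.1 hp).2,
    fun γ k hk => ?_⟩
  -- On the support `S` the map `k` factors through `h`: `ψ` evaluates `k` at a chosen preimage in
  -- `S`. The value `0` elsewhere is irrelevant.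
  let ψ : β → FreeAbelianGroup γ := fun b =>
    if hb : ∃ a ∈ S, h a = b then FreeAbelianGroup.of (k hb.choose) else 0
  have h₁ := hS _ (fun a => FreeAbelianGroup.of (k a)) (fun a => ψ (h a)) fun a ha => by
    have hb : ∃ a' ∈ S, h a' = h a := ⟨a, ha, rfl⟩
    simp only [ψ, dif_pos hb]
    congr 1
    exact (hk (hb.choose, a) (Finset.mem_filter.2
      ⟨Finset.mem_product.2 ⟨hb.choose_spec.1, ha⟩, hb.choose_spec.2⟩)).symm
  have h₂ : FreeAbelianGroup.lift (fun a => ψ (h a)) m =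
      FreeAbelianGroup.lift ψ (FreeAbelianGroup.map h m) :=
    DFunLike.congr_fun (FreeAbelianGroup.lift_ext
      (FreeAbelianGroup.lift (fun a => ψ (h a)))
      ((FreeAbelianGroup.lift ψ).comp (FreeAbelianGroup.map h)) fun a => by simp) m
  rw [hm, map_zero] at h₂
  exact h₁.trans h₂

end FreeAbelian

/-- Concatenating the tuples shows that any two polynomial stages over `X(U)` map to a common one.
-/
lemma Tuple.exists_common {U : Cᵒᵖ} {X : Over B} {P₁ P₂ : Tuple B} (h₁ : P₁.stage ⟶ atStage X U)
    (h₂ : P₂.stage ⟶ atStage X U) :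
    ∃ (P : Tuple B) (k₁ : P₁.stage ⟶ P.stage) (k₂ : P₂.stage ⟶ P.stage)
      (h : P.stage ⟶ atStage X U), k₁ ≫ h = h₁ ∧ k₂ ≫ h = h₂ := by
  let q : Fin (P₁.n + P₂.n) → Sec X U := Fin.append (fun j => h₁.map (Stage.var P₁.b j))
    (fun j => h₂.map (Stage.var P₂.b j))
  have e₁ : ∀ j, q (Fin.castAdd _ j) = h₁.map (Stage.var P₁.b j) := Fin.append_left _ _
  have e₂ : ∀ j, q (Fin.natAdd _ j) = h₂.map (Stage.var P₂.b j) := Fin.append_right _ _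
  have h₁' : ∀ j, augMap X U (q (Fin.castAdd _ j)) = bres B h₁.base (P₁.b j) := fun j => by
    rw [e₁]
    exact (h₁.aug_comm _).trans (congrArg _ (Stage.aug_var P₁.b j))
  have h₂' : ∀ j, augMap X U (q (Fin.natAdd _ j)) = bres B h₂.base (P₂.b j) := fun j => by
    rw [e₂]
    exact (h₂.aug_comm _).trans (congrArg _ (Stage.aug_var P₂.b j))
  let P : Tuple B := ⟨U, P₁.n + P₂.n, fun j => augMap X U (q j)⟩
  let h : P.stage ⟶ atStage X U := Stage.polyDesc (𝟙 U) q fun j => (bres_id U _).symm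
  refine ⟨P, Stage.polyDesc h₁.base (fun j => Stage.var P.b (Fin.castAdd _ j)) fun j =>
    (Stage.aug_var _ _).trans (h₁' j), Stage.polyDesc h₂.base
      (fun j => Stage.var P.b (Fin.natAdd _ j)) fun j => (Stage.aug_var _ _).trans (h₂' j), h,
      Stage.poly_hom_ext (Category.comp_id _) fun j => ?_,
      Stage.poly_hom_ext (Category.comp_id _) fun j => ?_⟩
  · refine (congrArg h.map (Stage.polyDesc_var _ _ _ _)).trans ?_
    exact (Stage.polyDesc_var _ _ _ _).trans (e₁ j)
  · refine (congrArg h.map (Stage.polyDesc_var _ _ _ _)).trans ?_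
    exact (Stage.polyDesc_var _ _ _ _).trans (e₂ j)

/-- Restriction of decorations along `h.base` need not be injective. Extending scalars to `U` first
makes the base morphism an identity. -/
lemma Tuple.exists_base_change {P : Tuple B} {U : Cᵒᵖ} {X : Over B} (h : P.stage ⟶ atStage X U) :
    ∃ (b : Fin P.n → B.right.obj.obj U) (k : P.stage ⟶ (Tuple.mk U P.n b).stage)
      (h' : (Tuple.mk U P.n b).stage ⟶ atStage X U), k ≫ h' = h ∧ h'.base = 𝟙 U := by
  let P' : Tuple B := ⟨U, P.n, fun j => bres B h.base (P.b j)⟩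
  let k : P.stage ⟶ P'.stage := Stage.polyDesc h.base (fun j => Stage.var P'.b j)
    fun j => Stage.aug_var P'.b j
  let h' : P'.stage ⟶ atStage X U := Stage.polyDesc (𝟙 U) (fun j => h.map (Stage.var P.b j))
    fun j => ((h.aug_comm _).trans (congrArg (bres B h.base) (Stage.aug_var P.b j))).trans
      (bres_id U _).symm
  refine ⟨P'.b, k, h', Stage.poly_hom_ext (Category.comp_id _) fun j => ?_, rfl⟩
  exact (congrArg h'.map (Stage.polyDesc_var _ _ _ _)).trans (Stage.polyDesc_var _ _ _ _)

/-- A functor on stages is locally finitary at `X` if its values at the stages of `X` are,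
locally, filtered colimits of its values at polynomial stages. -/
structure LocallyFinitary (X : Over B) (M : Stage B ⥤ AddCommGrpCat.{u + 1}) : Prop where
  surj : ∀ (U : C) (m : M.obj (atStage X (op U))), ∃ T ∈ K U, ∀ (V : C) (g : V ⟶ U), T g →
    ∃ (P : Tuple B) (h : P.stage ⟶ atStage X (op V)) (m' : M.obj P.stage),
      M.map h m' = M.map (atRes X g.op) m
  inj : ∀ (P : Tuple B) (U : C) (h : P.stage ⟶ atStage X (op U)) (m : M.obj P.stage),
    M.map h m = 0 → ∃ T ∈ K U, ∀ (V : C) (g : V ⟶ U), T g →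
      ∃ (P' : Tuple B) (k : P.stage ⟶ P'.stage) (h' : P'.stage ⟶ atStage X (op V)),
        k ≫ h' = h ≫ atRes X g.op ∧ M.map k m = 0

lemma map_comp_apply' (M : Stage B ⥤ AddCommGrpCat.{u + 1}) {Q R S : Stage B} (f : Q ⟶ R)
    (g : R ⟶ S) (m : M.obj Q) : M.map (f ≫ g) m = M.map g (M.map f m) :=
  congr($(M.map_comp f g) m)

/-- Elements of the kernel of a morphism of locally finitary functors come, locally, from the
kernel at a polynomial stage. -/
lemma LocallyFinitary.exists_of_app_eq_zero {M M' : Stage B ⥤ AddCommGrpCat.{u + 1}} (c : M ⟶ M')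
    {X : Over B} (hM : LocallyFinitary X M) (hM' : LocallyFinitary X M') (U : C)
    (m : M.obj (atStage X (op U))) (hm : c.app _ m = 0) :
    ∃ T ∈ K U, ∀ (V : C) (g : V ⟶ U), T g →
      ∃ (P : Tuple B) (h : P.stage ⟶ atStage X (op V)) (m' : M.obj P.stage),
        M.map h m' = M.map (atRes X g.op) m ∧ c.app _ m' = 0 := by
  refine exists_cover_bind (hM.surj U m) ?_
  rintro V g ⟨P, h, m', hm'⟩
  obtain ⟨T, hT, hl⟩ := hM'.inj P V h (c.app _ m') (by
    refine (congr($(c.naturality h) m')).symm.trans ?_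
    refine (congrArg (c.app _) hm').trans ?_
    refine (congr($(c.naturality (atRes X g.op)) m)).trans ?_
    exact (congrArg (M'.map _) hm).trans (map_zero (M'.map _).hom))
  refine ⟨T, hT, fun V' g' hg' => ?_⟩
  obtain ⟨P', k, h', hk, hm₀⟩ := hl V' g' hg'
  refine ⟨P', h', M.map k m', ?_, (congr($(c.naturality k) m')).trans hm₀⟩
  rw [← map_comp_apply', hk, map_comp_apply', hm', ← map_comp_apply', ← atRes_comp]
  rfl

namespace Shape

variable {W : Shape B} {X : Over B}

lemma El.exists_eq_mk_of_map_eq {Q R : Stage B} (f : Q ⟶ R)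
    (hf : ∀ i, Function.Injective (W.res i f.base)) {w w' : El W Q} (h : w.map f = w'.map f) :
    ∃ (i : W.ι) (ν : W.N i Q.base) (q q' : Fin (W.n i) → Q.ring) (hq : ∀ j, Q.aug (q j) = W.β i ν j)
      (hq' : ∀ j, Q.aug (q' j) = W.β i ν j), w = ⟨i, ν, q, hq⟩ ∧ w' = ⟨i, ν, q', hq'⟩ ∧
        ∀ j, f.map (q j) = f.map (q' j) := by
  obtain ⟨i, ν, q, hq⟩ := w
  obtain ⟨i', ν', q', hq'⟩ := w'
  obtain ⟨rfl, hν, hqq⟩ := El.mk.inj h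
  obtain rfl : ν = ν' := hf _ (eq_of_heq hν)
  exact ⟨i, ν, q, q', hq, hq', rfl, rfl, fun j => congrFun (eq_of_heq hqq) j⟩

/-- Over an identity of the base the two tuples have the same index and decoration, so they are two
morphisms `c`, `c'` from one polynomial stage that `h` equalizes. This is the situation of
`LocallyIndPoly`. -/
lemma El.exists_identify_of_base_eq (hX : LocallyIndPoly X) {U : C} {n : ℕ}
    {b : Fin n → B.right.obj.obj (op U)} (h : (Tuple.mk (op U) n b).stage ⟶ atStage X (op U))
    (hb : h.base = 𝟙 (op U)) (w w' : El W (Tuple.mk (op U) n b).stage) (hw : w.map h = w'.map h) :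
    ∃ T ∈ K U, ∀ (V : C) (g : V ⟶ U), T g →
      ∃ (P' : Tuple B) (k : (Tuple.mk (op U) n b).stage ⟶ P'.stage)
        (h' : P'.stage ⟶ atStage X (op V)), k ≫ h' = h ≫ atRes X g.op ∧ w.map k = w'.map k := by
  obtain ⟨i, ν, q, q', hq, hq', rfl, rfl, hqq⟩ := El.exists_eq_mk_of_map_eq h (fun i ν ν' e => by
    rw [hb] at e
    exact (W.res_id _ _).symm.trans (e.trans (W.res_id _ _))) hw
  let P₁ : Tuple B := ⟨op U, W.n i, W.β i ν⟩
  let c : P₁.stage ⟶ (Tuple.mk (op U) n b).stage :=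
    Stage.polyDesc (𝟙 (op U)) q fun j => (hq j).trans (bres_id (op U) _).symm
  let c' : P₁.stage ⟶ (Tuple.mk (op U) n b).stage :=
    Stage.polyDesc (𝟙 (op U)) q' fun j => (hq' j).trans (bres_id (op U) _).symm
  have hcb : (c ≫ h).base = (c' ≫ h).base :=
    congrArg (· ≫ h.base) ((Stage.polyDesc_base (𝟙 (op U)) q _).trans
      (Stage.polyDesc_base (𝟙 (op U)) q' _).symm)
  have hc : ∀ j, c.map (Stage.var P₁.b j) = q j := Stage.polyDesc_var _ _ _
  have hc' : ∀ j, c'.map (Stage.var P₁.b j) = q' j := Stage.polyDesc_var _ _ _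
  obtain ⟨T, hT, hl⟩ := hX P₁ ⟨op U, _, b⟩ c c' U h (Stage.poly_hom_ext hcb fun j =>
    (congrArg h.map (hc j)).trans ((hqq j).trans
      (congrArg h.map (hc' j)).symm))
  refine ⟨T, hT, fun V g hg => ?_⟩
  obtain ⟨P, k, h', hk, hcc⟩ := hl V g hg
  refine ⟨P, k, h', hk, El.ext' rfl (funext fun j => ?_)⟩
  exact (congrArg k.map (hc j)).symm.trans
    (congr(Stage.Hom.map $hcc (Stage.var P₁.b j)).trans (congrArg k.map (hc' j)))

lemma El.exists_identify (hX : LocallyIndPoly X) {P : Tuple B} {U : C}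
    (h : P.stage ⟶ atStage X (op U)) (w w' : El W P.stage) (hw : w.map h = w'.map h) :
    ∃ T ∈ K U, ∀ (V : C) (g : V ⟶ U), T g →
      ∃ (P' : Tuple B) (k : P.stage ⟶ P'.stage) (h' : P'.stage ⟶ atStage X (op V)),
        k ≫ h' = h ≫ atRes X g.op ∧ w.map k = w'.map k := by
  obtain ⟨b, k₀, h₀, rfl, hb⟩ := P.exists_base_change h
  obtain ⟨T, hT, hl⟩ := El.exists_identify_of_base_eq hX h₀ hb (w.map k₀) (w'.map k₀) (by
    rw [← El.map_comp, ← El.map_comp]; exact hw)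
  refine ⟨T, hT, fun V g hg => ?_⟩
  obtain ⟨P', k, h', hk, hkw⟩ := hl V g hg
  refine ⟨P', k₀ ≫ k, h', by rw [Category.assoc, hk, Category.assoc], ?_⟩
  rw [El.map_comp, El.map_comp, hkw]

/-- The pairs are identified one at a time, each after a further refinement and a further polynomial
stage. -/
lemma El.exists_identify_finset (hX : LocallyIndPoly X) {P : Tuple B} {U : C}
    (h : P.stage ⟶ atStage X (op U)) (L : Finset (El W P.stage × El W P.stage))
    (hL : ∀ p ∈ L, p.1.map h = p.2.map h) :
    ∃ T ∈ K U, ∀ (V : C) (g : V ⟶ U), T g →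
      ∃ (P' : Tuple B) (k : P.stage ⟶ P'.stage) (h' : P'.stage ⟶ atStage X (op V)),
        k ≫ h' = h ≫ atRes X g.op ∧ ∀ p ∈ L, p.1.map k = p.2.map k := by
  classical
  induction L using Finset.induction_on with
  | empty =>
    exact exists_cover_self fun V g => ⟨P, 𝟙 _, h ≫ atRes X g.op, Category.id_comp _, by simp⟩
  | insert a s _ ih =>
    refine exists_cover_bind (ih fun p hp => hL p (Finset.mem_insert_of_mem hp)) ?_
    rintro V g ⟨P', k, h', hk, hs⟩
    obtain ⟨T, hT, hl⟩ := El.exists_identify hX h' (a.1.map k) (a.2.map k) (by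
      rw [← El.map_comp, ← El.map_comp, hk, El.map_comp, El.map_comp,
        hL a (Finset.mem_insert_self _ _)])
    refine ⟨T, hT, fun V' g' hg' => ?_⟩
    obtain ⟨P'', k', h'', hk', ha⟩ := hl V' g' hg'
    refine ⟨P'', k ≫ k', h'', ?_, fun p hp => ?_⟩
    · rw [Category.assoc, hk', reassoc_of% hk, op_comp, atRes_comp]
    · rw [El.map_comp, El.map_comp]
      rcases Finset.mem_insert.1 hp with rfl | hp
      · exact ha
      · rw [hs p hp]

lemma exists_free_map_eq {U : Cᵒᵖ} (m : W.free.obj (atStage X U)) :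
    ∃ (P : Tuple B) (h : P.stage ⟶ atStage X U) (m' : W.free.obj P.stage), W.free.map h m' = m := by
  refine FreeAbelianGroup.induction_on (motive := fun m => ∃ (P : Tuple B)
    (h : P.stage ⟶ atStage X U) (m' : W.free.obj P.stage), W.free.map h m' = m) m ?_ ?_ ?_ ?_
  · exact ⟨⟨U, 0, Fin.elim0⟩, Stage.polyDesc (𝟙 U) Fin.elim0 fun j => j.elim0, 0,
      map_zero (W.free.map _).hom⟩
  · intro w
    let P : Tuple B := ⟨U, W.n w.i, W.β w.i w.ν⟩
    refine ⟨P, Stage.polyDesc (𝟙 U) w.q fun j => (w.aug_q j).trans (bres_id U _).symm,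
      W.of ⟨w.i, w.ν, fun j => Stage.var P.b j, fun j => Stage.aug_var P.b j⟩, ?_⟩
    refine (free_map_of _ _ _).trans (congrArg W.of ?_)
    exact El.ext' (W.res_id _ _) (funext fun j => Stage.polyDesc_var _ _ _ _)
  · rintro w ⟨P, h, m', hm'⟩
    exact ⟨P, h, -m', (map_neg (W.free.map h).hom m').trans (congrArg Neg.neg hm')⟩
  · rintro x y ⟨P₁, h₁, x', hx⟩ ⟨P₂, h₂, y', hy⟩
    -- To add two elements, their stages are first replaced by a common one.
    obtain ⟨P, k₁, k₂, h, rfl, rfl⟩ := Tuple.exists_common h₁ h₂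
    refine ⟨P, h, W.free.map k₁ x' + W.free.map k₂ y', ?_⟩
    refine (map_add (W.free.map h).hom _ _).trans ?_
    exact congr($((map_comp_apply' _ _ _ _).symm.trans hx) +
      $((map_comp_apply' _ _ _ _).symm.trans hy))

/-- An element of a free group dies because of finitely many coincidences between generators, and
these already hold, locally, at a polynomial stage. -/
lemma locallyFinitary_free (hX : LocallyIndPoly X) : LocallyFinitary X W.free where
  surj U m := exists_cover_self fun V g => exists_free_map_eq _
  inj P U h m hm := by
    obtain ⟨L, hL, hk⟩ := exists_pairs_of_map_eq_zero.{u + 1} (El.map h) m hm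
    obtain ⟨T, hT, hl⟩ := El.exists_identify_finset hX h L hL
    refine ⟨T, hT, fun V g hg => ?_⟩
    obtain ⟨P', k, h', hkh, hL'⟩ := hl V g hg
    exact ⟨P', k, h', hkh, hk _ (El.map k) hL'⟩

end Shape

end TopAlg

/-! ### Resolutions by free functors -/

namespace TopAlg

variable {C : Type u} [SmallCategory C] {K : GrothendieckTopology C}
variable {A : Sheaf K CommRingCat.{u}} {B : Under A}

namespace Shape

/-! ### Free functors with prescribed image: sums of functors represented by polynomial stages -/

section OfSubset

variable (M : Stage B ⥤ AddCommGrpCat.{u + 1}) (R : ∀ P : Tuple B, Set (M.obj P.stage))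

/-- The shape of tuples that represent the images of given elements at polynomial stages. -/
def ofSubset : Shape B where
  ι := Σ P : Tuple B, R P
  n i := i.1.n
  N i V := ULift.{u + 1} (i.1.base ⟶ V)
  res _ _ _ g ν := ⟨ν.down ≫ g⟩
  res_id _ _ ν := ULift.ext _ _ (Category.comp_id ν.down)
  res_comp _ _ _ _ g h ν := ULift.ext _ _ (Category.assoc ν.down g h).symm
  β i _ ν j := bres B ν.down (i.1.b j)
  β_res i _ _ g ν j := bres_comp ν.down g (i.1.b j)

variable {M R}

/-- The morphism from a polynomial stage that is classified by a tuple. -/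
noncomputable def El.desc {Q : Stage B} (w : El (ofSubset M R) Q) : w.i.1.stage ⟶ Q :=
  Stage.polyDesc w.ν.down w.q w.aug_q

lemma El.desc_map {Q Q' : Stage B} (f : Q ⟶ Q') (w : El (ofSubset M R) Q) :
    (w.map f).desc = w.desc ≫ f :=
  Stage.poly_hom_ext rfl fun j => (Stage.polyDesc_var _ _ (w.map f).aug_q j).trans
    (congrArg f.map (Stage.polyDesc_var _ _ w.aug_q j)).symm

variable (M R) in
/-- The morphism whose image is generated by the images of given elements at polynomial stages. -/
noncomputable def ofSubsetDesc : (ofSubset M R).free ⟶ M :=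
  freeDesc _ (fun _ w => M.map w.desc w.i.2.1) (fun f w => by
    rw [El.desc_map]
    exact map_comp_apply' M w.desc f w.i.2.1)

lemma ofSubsetDesc_of {Q : Stage B} (w : El (ofSubset M R) Q) :
    (ofSubsetDesc M R).app Q ((ofSubset M R).of w) = M.map w.desc w.i.2.1 :=
  freeDesc_of _ _ _ w

lemma exists_ofSubsetDesc_eq {P : Tuple B} {Q : Stage B} (h : P.stage ⟶ Q) (m : M.obj P.stage)
    (hm : m ∈ R P) : ∃ w : El (ofSubset M R) Q,
      (ofSubsetDesc M R).app Q ((ofSubset M R).of w) = M.map h m := by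
  let w : El (ofSubset M R) Q := ⟨⟨P, m, hm⟩, ⟨h.base⟩, fun j => h.map (Stage.var P.b j), fun j =>
    (h.aug_comm _).trans (congrArg (bres B h.base) (Stage.aug_var P.b j))⟩
  have hw : w.desc = h := Stage.poly_hom_ext rfl fun j => Stage.polyDesc_var _ _ w.aug_q j
  exact ⟨w, (ofSubsetDesc_of w).trans (congrArg (fun h => M.map h m) hw)⟩

lemma ofSubsetDesc_comp {M' : Stage B ⥤ AddCommGrpCat.{u + 1}} (c : M ⟶ M')
    (h : ∀ P, ∀ m ∈ R P, c.app _ m = 0) : ofSubsetDesc M R ≫ c = 0 := by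
  ext Q : 2
  refine free_hom_ext fun w => ?_
  refine (congrArg (c.app Q) (ofSubsetDesc_of w)).trans ?_
  refine (congr($(c.naturality w.desc) w.i.2.1)).trans ?_
  exact (congrArg (M'.map _) (h _ _ w.i.2.2)).trans (map_zero (M'.map _).hom)

end OfSubset

end Shape

/-! ### Exactness over locally ind-polynomial algebras -/

section Exactness

variable {I : Cᵒᵖ ⥤ AddCommGrpCat.{u + 1}}

/-- Since `y` kills the kernel of `f`, it descends to the image of `f`, from which it extends by
injectivity of `I`. -/
lemma exists_extension [Injective I] {F G : Cᵒᵖ ⥤ AddCommGrpCat.{u + 1}} (f : F ⟶ G) (y : F ⟶ I)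
    (h : ∀ V (m : F.obj V), f.app V m = 0 → y.app V m = 0) : ∃ x : G ⟶ I, f ≫ x = y := by
  have hS : (ShortComplex.mk (kernel.ι f) f (kernel.condition f)).Exact :=
    ShortComplex.exact_of_f_is_kernel _ (kernelIsKernel f)
  have hy : kernel.ι f ≫ y = 0 := by
    ext V m
    exact h V _ congr(($(kernel.condition f)).app V m)
  exact ⟨hS.descToInjective y hy, hS.comp_descToInjective y hy⟩

lemma homPresheafMap_comp {M M' M'' : Stage B ⥤ AddCommGrpCat.{u + 1}} (α : M ⟶ M') (β : M' ⟶ M'') :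
    homPresheafMap I β ≫ homPresheafMap I α = homPresheafMap I (α ≫ β) := by
  ext X y
  exact homEv_ext (X := X.unop) fun V m => rfl

lemma homPresheafMap_zero {M M' : Stage B ⥤ AddCommGrpCat.{u + 1}} :
    homPresheafMap I (0 : M ⟶ M') = 0 := by
  ext X y
  refine homEv_ext (X := X.unop) fun V m => ?_
  exact map_zero (homEv (X := X.unop) y V)

/-- Vanishing of `y` at kernel elements from polynomial stages suffices: every kernel element is
locally of this kind, and sections of the sheaf `I` vanish if they do so locally. -/
lemma exists_homPresheafMap_eq [Injective I]
    (hI : Presieve.IsSheaf K (I ⋙ forget AddCommGrpCat)) {X : Over B}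
    {M M' : Stage B ⥤ AddCommGrpCat.{u + 1}} (c : M ⟶ M') (hM : LocallyFinitary X M)
    (hM' : LocallyFinitary X M') (y : (homPresheaf I M).obj (op X))
    (hy : ∀ (P : Tuple B) (V : Cᵒᵖ) (h : P.stage ⟶ atStage X V) (m : M.obj P.stage),
      c.app _ m = 0 → homEv y V (M.map h m) = 0) :
    ∃ x, (homPresheafMap I c).app (op X) x = y := by
  refine exists_extension (Functor.whiskerLeft (Stage.ofAlg X) c)
    (show Stage.ofAlg X ⋙ M ⟶ I from y) fun V m hm => ?_
  obtain ⟨T, hT, hl⟩ := hM.exists_of_app_eq_zero c hM' V.unop m hm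
  change homEv y V m = 0
  refine eq_of_cover (U := V.unop) hI hT fun V' g hg => ?_
  obtain ⟨P, h, m', hm', hc⟩ := hl V' g hg
  refine (homEv_res y g.op m).symm.trans ?_
  refine (congrArg (homEv y (op V')) hm').symm.trans ?_
  exact (hy P _ h m' hc).trans (map_zero (I.map g.op).hom).symm

end Exactness

variable (B) in
/-- A morphism between free functors on decorated tuples. -/
structure FreeMap where
  /-- the target -/
  tgt : Shape B
  /-- the source -/
  src : Shape B
  /-- the morphism -/
  map : src.free ⟶ tgt.free

namespace FreeMap

/-- A free cover of the kernel of a morphism of free functors. -/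
noncomputable def next (s : FreeMap B) : FreeMap B where
  tgt := s.src
  src := Shape.ofSubset s.src.free fun _ => {m | s.map.app _ m = 0}
  map := Shape.ofSubsetDesc _ _

/-- The iterated free covers of kernels. -/
noncomputable def iter (s : FreeMap B) : ℕ → FreeMap B
  | 0 => s
  | n + 1 => (iter s n).next

variable (s : FreeMap B) (I : Cᵒᵖ ⥤ AddCommGrpCat.{u + 1}) (τ : GrothendieckTopology (Over B))
  (hτ : τ ≤ liftTopology B) (hI : Presieve.IsSheaf K (I ⋙ forget AddCommGrpCat.{u + 1}))

variable {τ I}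

/-- The sheaf of homomorphisms from a free functor on decorated tuples. -/
def homSheaf (W : Shape B) : Sheaf τ AddCommGrpCat.{u + 1} :=
  ⟨homPresheaf I W.free, fun E =>
    Presieve.isSheaf_of_le _ hτ (Shape.isSheaf_homPresheaf_free hI E)⟩

instance [Injective I] (W : Shape B) : Injective (homSheaf hτ hI W) := injective_sheaf_mk _

/-- The morphism of sheaves induced by a morphism of free functors. -/
def homSheafMap : homSheaf hτ hI s.tgt ⟶ homSheaf hτ hI s.src := ⟨homPresheafMap I s.map⟩

lemma subsingleton_H_kernel_homSheafMap [Injective I] (hτ' : uniformLiftTopology B ≤ τ)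
    {T : Over B} (hT : IsTerminal T) (hT' : LocallyIndPoly T) (p : ℕ) :
    Subsingleton (Sheaf.H.{u + 1} (kernel (homSheafMap s hτ hI)) (p + 1)) := by
  refine subsingleton_H_kernel (fun n => homSheaf hτ hI (s.iter n).tgt)
    (fun n => homSheafMap (s.iter n) hτ hI) (fun n => ?_) LocallyIndPoly
    (exists_cover_locallyIndPoly hτ') hT hT' (fun n X hX y hy => ?_) p 0
  · apply Sheaf.hom_ext
    refine (homPresheafMap_comp _ _).trans ?_
    refine (congrArg (homPresheafMap I) (Shape.ofSubsetDesc_comp _ fun P m hm => hm)).trans ?_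
    exact homPresheafMap_zero
  · refine exists_homPresheafMap_eq hI (s.iter n).map (Shape.locallyFinitary_free hX)
      (Shape.locallyFinitary_free hX) y fun P V h m hm => ?_
    -- The next free cover hits every kernel element that comes from a polynomial stage, so a
    -- cocycle `y` vanishes there.
    obtain ⟨w, hw⟩ := Shape.exists_ofSubsetDesc_eq (M := (s.iter n).src.free)
      (R := fun _ => {m | (s.iter n).map.app _ m = 0}) h m hm
    refine (congrArg (homEv y V) hw).symm.trans ?_
    exact congr(homEv $hy V (Shape.of _ w))

end FreeMap

end TopAlg

/-! ### Coinduced modules -/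

namespace TopAlg

variable {C : Type u} [SmallCategory C] {K : GrothendieckTopology C}
variable {A : Sheaf K CommRingCat.{u}} {B : Under A}

section Coinduced

variable (B) (I : Cᵒᵖ ⥤ AddCommGrpCat.{u})

/-- Natural families of additive maps from the sections of `B` over an object `U` to those of an
abelian presheaf `I`. -/
def coindSubgroup (U : Cᵒᵖ) : AddSubgroup (∀ V : Cᵒᵖ, (U ⟶ V) → (B.right.obj.obj V →+ I.obj V)) where
  carrier := {k | ∀ (V W : Cᵒᵖ) (g : U ⟶ V) (h : V ⟶ W) (b : B.right.obj.obj V),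
    k W (g ≫ h) (bres B h b) = I.map h (k V g b)}
  zero_mem' _ _ _ h _ := (map_zero (I.map h).hom).symm
  add_mem' hk hl V W g h b :=
    (congr($(hk V W g h b) + $(hl V W g h b))).trans (map_add (I.map h).hom _ _).symm
  neg_mem' hk V W g h b := (congr(-$(hk V W g h b))).trans (map_neg (I.map h).hom _).symm

/-- The sections over `U` of the `B`-module coinduced by an abelian presheaf. -/
abbrev Coind (U : Cᵒᵖ) : Type u := coindSubgroup B I U

namespace Coind

variable {B I}

lemma ext' {U : Cᵒᵖ} {k l : Coind B I U} (h : ∀ V (g : U ⟶ V) b, k.1 V g b = l.1 V g b) : k = l :=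
  Subtype.ext (funext fun V => funext fun g => AddMonoidHom.ext (h V g))

/-- Restriction of coinduced sections. -/
def res {U V : Cᵒᵖ} (f : U ⟶ V) : Coind B I U →+ Coind B I V where
  toFun k := ⟨fun W g => k.1 W (f ≫ g), fun W W' g h b =>
    (congrArg (fun g => k.1 W' g (bres B h b)) (Category.assoc f g h).symm).trans
      (k.2 W W' (f ≫ g) h b)⟩
  map_zero' := rfl
  map_add' _ _ := rfl

instance (U : Cᵒᵖ) : SMul (B.right.obj.obj U) (Coind B I U) where
  smul r k := ⟨fun V g => (k.1 V g).comp (AddMonoidHom.mulLeft (bres B g r)), fun V W g h b => by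
    refine Eq.trans ?_ (k.2 V W g h (bres B g r * b))
    rw [map_mul, ← bres_comp]
    rfl⟩

lemma smul_apply {U V : Cᵒᵖ} (r : B.right.obj.obj U) (k : Coind B I U) (g : U ⟶ V)
    (b : B.right.obj.obj V) : (r • k).1 V g b = k.1 V g (bres B g r * b) := rfl

instance (U : Cᵒᵖ) : Module (B.right.obj.obj U) (Coind B I U) where
  one_smul k := ext' fun V g b => by rw [smul_apply, map_one, one_mul]
  mul_smul r s k := ext' fun V g b => by
    rw [smul_apply, smul_apply, smul_apply, (bres B g).map_mul, mul_comm (bres B g r), mul_assoc]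
  smul_zero r := rfl
  smul_add r k l := rfl
  add_smul r s k := ext' fun V g b => by
    rw [smul_apply, map_add, add_mul, map_add]
    rfl
  zero_smul k := ext' fun V g b => by
    rw [smul_apply, map_zero, zero_mul, map_zero]
    rfl

variable (B I) in
/-- The abelian presheaf underlying the coinduced module. -/
def abPresheaf : Cᵒᵖ ⥤ AddCommGrpCat.{u} where
  obj U := AddCommGrpCat.of (Coind B I U)
  map f := AddCommGrpCat.ofHom (res f)
  map_id U := AddCommGrpCat.hom_ext (AddMonoidHom.ext fun (k : Coind B I U) =>
    ext' fun V g b => congrArg (fun g => k.1 V g b) (Category.id_comp g))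
  map_comp f f' := AddCommGrpCat.hom_ext (AddMonoidHom.ext fun (k : Coind B I _) =>
    ext' fun V g b => congrArg (fun g => k.1 V g b) (Category.assoc f f' g))

instance (U : Cᵒᵖ) : Module ((ringOf B).obj.obj U) ((abPresheaf B I).obj U) :=
  inferInstanceAs (Module (B.right.obj.obj U) (Coind B I U))

variable (B I) in
/-- The presheaf of `B`-modules coinduced by an abelian presheaf. -/
noncomputable def presheaf : PresheafOfModules.{u} (ringOf B).obj :=
  PresheafOfModules.ofPresheaf (abPresheaf B I) fun {U V} f r k => by
    refine ext' (I := I) (B := B) (U := V) fun W g b => ?_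
    exact congrArg (fun r => (show Coind B I U from k).1 W (f ≫ g) (r * b)) (bres_comp f g r)

end Coind

variable {B I}

/-- The forgetful functor is right adjoint to exact sheafification. Injectivity among presheaves
lets `J` split off the coinduced module without any check that the latter is a sheaf. -/
lemma injective_val (J : SheafOfModules.{u} (ringOf B)) [Injective J] : Injective J.val :=
  Injective.injective_of_adjoint (PresheafOfModules.sheafificationAdjunction (𝟙 (ringOf B).obj)) J

variable {J : SheafOfModules.{u} (ringOf B)} (ι : J.val.presheaf ⟶ I)

/-- The value of a morphism of abelian presheaves on a section of a module. -/
noncomputable def modEv (U : Cᵒᵖ) : Der.Mod J U →+ I.obj U := (ι.app U).hom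

lemma modEv_res {U V : Cᵒᵖ} (g : U ⟶ V) (j : Der.Mod J U) :
    modEv ι V (Der.mres J g j) = I.map g (modEv ι U j) :=
  congr($(ι.naturality g) j)

/-- The section of the coinduced module that corresponds to a section of a module. -/
noncomputable def toCoindApp (U : Cᵒᵖ) : Der.Mod J U →+ Coind B I U where
  toFun j := ⟨fun V g => (modEv ι V).comp
    ((smulAddHom (B.right.obj.obj V) (Der.Mod J V)).flip (Der.mres J g j)), fun V W g h b => by
      refine Eq.trans ?_ (modEv_res ι h (b • Der.mres J g j))
      rw [Der.mres_smul, ← Der.mres_comp]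
      rfl⟩
  map_zero' := Coind.ext' fun V g b => by
    change modEv ι V (b • Der.mres J g 0) = 0
    rw [map_zero, smul_zero, map_zero]
  map_add' j j' := Coind.ext' fun V g b => by
    change modEv ι V (b • Der.mres J g (j + j')) =
      modEv ι V (b • Der.mres J g j) + modEv ι V (b • Der.mres J g j')
    rw [map_add, smul_add, map_add]

lemma toCoindApp_apply {U V : Cᵒᵖ} (j : Der.Mod J U) (g : U ⟶ V) (b : B.right.obj.obj V) :
    (toCoindApp ι U j).1 V g b = modEv ι V (b • Der.mres J g j) := rfl

/-- Evaluation at the identity and at `1` recovers `modEv ι U j`. -/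
lemma toCoindApp_injective (hι : ∀ U, Function.Injective (modEv ι U)) (U : Cᵒᵖ) :
    Function.Injective (toCoindApp ι U) := by
  intro j j' h
  have := congr(($h).1 U (𝟙 U) 1)
  rw [toCoindApp_apply, toCoindApp_apply, one_smul, one_smul, Der.mres_id, Der.mres_id] at this
  exact hι U this

lemma toCoindApp_smul (U : Cᵒᵖ) (r : B.right.obj.obj U) (j : Der.Mod J U) :
    toCoindApp ι U (r • j) = r • toCoindApp ι U j := Coind.ext' fun V g b => by
  rw [toCoindApp_apply, Coind.smul_apply, toCoindApp_apply, Der.mres_smul, smul_smul, mul_comm]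

/-- A module maps to the module coinduced by an abelian presheaf that it maps to. -/
noncomputable def toCoind : J.val ⟶ Coind.presheaf B I :=
  PresheafOfModules.homMk
    { app U := AddCommGrpCat.ofHom (Y := Coind B I U) (toCoindApp ι U)
      naturality U V f := AddCommGrpCat.hom_ext (AddMonoidHom.ext fun (j : Der.Mod J U) =>
        Coind.ext' (I := I) (B := B) fun W g b => by
          change modEv ι W (b • Der.mres J g (Der.mres J f j)) = modEv ι W (b • Der.mres J (f ≫ g) j)
          rw [Der.mres_comp]) }
    (fun U => toCoindApp_smul ι U)

/-- The embedding `toCoind ι` splits because its source is injective. The retraction is recorded by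
its components: linear, compatible with restriction, inverse to the embedding on `J`. -/
lemma exists_coind_retraction [Injective J] (hι : ∀ U, Function.Injective (modEv ι U)) :
    ∃ r : ∀ U, Coind B I U →+ Der.Mod J U,
      (∀ U (b : B.right.obj.obj U) (k : Coind B I U), r U (b • k) = b • r U k) ∧
      (∀ {U V : Cᵒᵖ} (g : U ⟶ V) (k : Coind B I U), r V (Coind.res g k) = Der.mres J g (r U k)) ∧
      ∀ U (j : Der.Mod J U), r U (toCoindApp ι U j) = j := by
  have : Injective J.val := injective_val J
  have : Mono (toCoind ι) :=
    PresheafOfModules.mono_of_injective fun {U} => toCoindApp_injective ι hι U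
  let ρ : Coind.presheaf B I ⟶ J.val := Injective.factorThru (𝟙 _) (toCoind ι)
  have hρ : toCoind ι ≫ ρ = 𝟙 _ := Injective.comp_factorThru _ _
  refine ⟨fun U => (ρ.app U).hom.toAddMonoidHom, fun U b k => ?_, fun {U V} g k => ?_, fun U j => ?_⟩
  · exact (ρ.app U).hom.map_smul b k
  · exact PresheafOfModules.naturality_apply ρ g k
  · exact congr(($hρ).app U j)

end Coinduced

end TopAlg

/-! ### Relations between differentials -/

namespace TopAlg

variable {C : Type u} [SmallCategory C] {K : GrothendieckTopology C}
variable {A : Sheaf K CommRingCat.{u}} {B : Under A}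

section Relations

variable (B) in
/-- The shape of pairs of a section of an algebra and a section of `B`. -/
def pairShape : Shape B where
  ι := PUnit
  n _ := 1
  N _ V := ULift.{u + 1} (B.right.obj.obj V × B.right.obj.obj V)
  res _ _ _ g ν := ⟨(bres B g ν.down.1, bres B g ν.down.2)⟩
  res_id _ _ _ := ULift.ext _ _ (Prod.ext (bres_id _ _) (bres_id _ _))
  res_comp _ _ _ _ g h _ := ULift.ext _ _ (Prod.ext (bres_comp g h _) (bres_comp g h _))
  β _ _ ν _ := ν.down.1
  β_res _ _ _ _ _ _ := rfl

/-- A pair of a section of an algebra and a section of `B`. -/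
def pairEl {Q : Stage B} (q : Q.ring) (b : B.right.obj.obj Q.base) : Shape.El (pairShape B) Q :=
  ⟨⟨⟩, ⟨(Q.aug q, b)⟩, fun _ => q, fun _ => rfl⟩

lemma pairEl_map {Q R : Stage B} (f : Q ⟶ R) (q : Q.ring) (b : B.right.obj.obj Q.base) :
    (pairEl q b).map f = pairEl (f.map q) (bres B f.base b) :=
  Shape.El.ext' (ULift.ext _ _ (Prod.ext (f.aug_comm q).symm rfl)) rfl

lemma eq_pairEl {Q : Stage B} (w : Shape.El (pairShape B) Q) :
    w = pairEl (w.q (0 : Fin 1)) w.ν.down.2 := by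
  obtain ⟨⟨⟩, ⟨⟨a, b⟩⟩, q, hq⟩ := w
  refine Shape.El.ext' (ULift.ext _ _ (Prod.ext (hq (0 : Fin 1)).symm rfl)) (funext fun j => ?_)
  exact congrArg q (Subsingleton.elim (α := Fin 1) _ _)

/-- The generator given by a pair of a section of an algebra and a section of `B`. -/
def pairOf {Q : Stage B} (q : Q.ring) (b : B.right.obj.obj Q.base) : (pairShape B).free.obj Q :=
  (pairShape B).of (pairEl q b)

lemma pairOf_map {Q R : Stage B} (f : Q ⟶ R) (q : Q.ring) (b : B.right.obj.obj Q.base) :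
    (pairShape B).free.map f (pairOf q b) = pairOf (f.map q) (bres B f.base b) :=
  (Shape.free_map_of _ _ _).trans (congrArg _ (pairEl_map f q b))

/-- The relations between pairs that are imposed on symbols `b · dq`. -/
inductive DerRel (Q : Stage B) : (pairShape B).free.obj Q → Prop
  | add (q q' : Q.ring) (b : B.right.obj.obj Q.base) :
      DerRel Q (pairOf (q + q') b - pairOf q b - pairOf q' b)
  | add_right (q : Q.ring) (b b' : B.right.obj.obj Q.base) :
      DerRel Q (pairOf q (b + b') - pairOf q b - pairOf q b')
  | mul (q q' : Q.ring) (b : B.right.obj.obj Q.base) :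
      DerRel Q (pairOf (q * q') b - pairOf q' (b * Q.aug q) - pairOf q (b * Q.aug q'))
  | str (a : A.obj.obj Q.base) (b : B.right.obj.obj Q.base) : DerRel Q (pairOf (Q.str a) b)

lemma map_sub_sub {M : Stage B ⥤ AddCommGrpCat.{u + 1}} {Q R : Stage B} (f : Q ⟶ R)
    (x y z : M.obj Q) : M.map f (x - y - z) = M.map f x - M.map f y - M.map f z :=
  (map_sub (M.map f).hom _ _).trans (congrArg (· - _) (map_sub (M.map f).hom _ _))

lemma map_pairOf_add {Q R : Stage B} (f : Q ⟶ R) (q q' : Q.ring) (b : B.right.obj.obj Q.base) :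
    (pairShape B).free.map f (pairOf (q + q') b - pairOf q b - pairOf q' b) =
      pairOf (f.map q + f.map q') (bres B f.base b) - pairOf (f.map q) (bres B f.base b) -
        pairOf (f.map q') (bres B f.base b) := by
  rw [map_sub_sub, pairOf_map, pairOf_map, pairOf_map, map_add]

lemma map_pairOf_add_right {Q R : Stage B} (f : Q ⟶ R) (q : Q.ring)
    (b b' : B.right.obj.obj Q.base) :
    (pairShape B).free.map f (pairOf q (b + b') - pairOf q b - pairOf q b') =
      pairOf (f.map q) (bres B f.base b + bres B f.base b') - pairOf (f.map q) (bres B f.base b) -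
        pairOf (f.map q) (bres B f.base b') := by
  rw [map_sub_sub, pairOf_map, pairOf_map, pairOf_map, map_add]

lemma map_pairOf_mul {Q R : Stage B} (f : Q ⟶ R) (q q' : Q.ring) (b : B.right.obj.obj Q.base) :
    (pairShape B).free.map f (pairOf (q * q') b - pairOf q' (b * Q.aug q) -
        pairOf q (b * Q.aug q')) =
      pairOf (f.map q * f.map q') (bres B f.base b) -
        pairOf (f.map q') (bres B f.base b * R.aug (f.map q)) -
        pairOf (f.map q) (bres B f.base b * R.aug (f.map q')) := by
  rw [map_sub_sub, pairOf_map, pairOf_map, pairOf_map, map_mul, map_mul, map_mul, f.aug_comm,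
    f.aug_comm]

lemma map_pairOf_str {Q R : Stage B} (f : Q ⟶ R) (a : A.obj.obj Q.base)
    (b : B.right.obj.obj Q.base) : (pairShape B).free.map f (pairOf (Q.str a) b) =
      pairOf (R.str (A.obj.map f.base a)) (bres B f.base b) := by
  rw [pairOf_map, f.str_comm]

lemma DerRel.map {Q R : Stage B} (f : Q ⟶ R) {m : (pairShape B).free.obj Q} (hm : DerRel Q m) :
    DerRel R ((pairShape B).free.map f m) := by
  cases hm with
  | add q q' b => rw [map_pairOf_add]; exact .add _ _ _
  | add_right q b b' => rw [map_pairOf_add_right]; exact .add_right _ _ _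
  | mul q q' b => rw [map_pairOf_mul]; exact .mul _ _ _
  | str a b => rw [map_pairOf_str]; exact .str _ _

/-- The morphism lies over an identity of the site. Only surjectivity on sections of `A` and `B` is
retained of this, enough to lift coefficients. -/
lemma exists_poly_hom (Q : Stage B) {n : ℕ} (q : Fin n → Q.ring) :
    ∃ (P : Tuple B) (h : P.stage ⟶ Q) (v : Fin n → P.stage.ring),
      (∀ j, h.map (v j) = q j) ∧ Function.Surjective (bres B h.base) ∧
        Function.Surjective (A.obj.map h.base) := by
  let P : Tuple B := ⟨Q.base, n, fun j => Q.aug (q j)⟩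
  exact ⟨P, Stage.polyDesc (𝟙 Q.base) q fun j => (bres_id Q.base _).symm, Stage.var P.b,
    Stage.polyDesc_var _ _ _, fun b => ⟨b, bres_id Q.base b⟩,
    fun a => ⟨a, congr($(A.obj.map_id Q.base) a)⟩⟩

/-- Every relation comes from a polynomial stage. -/
lemma DerRel.exists_poly {Q : Stage B} {m : (pairShape B).free.obj Q} (hm : DerRel Q m) :
    ∃ (P : Tuple B) (h : P.stage ⟶ Q) (m' : (pairShape B).free.obj P.stage),
      DerRel P.stage m' ∧ (pairShape B).free.map h m' = m := by
  cases hm with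
  | add q q' b =>
    obtain ⟨P, h, v, hv, hb, -⟩ := exists_poly_hom Q ![q, q']
    obtain ⟨b, rfl⟩ := hb b
    have h₀ : h.map (v 0) = q := hv 0
    have h₁ : h.map (v 1) = q' := hv 1
    exact ⟨P, h, _, .add (v 0) (v 1) b, by rw [map_pairOf_add, h₀, h₁]⟩
  | add_right q b b' =>
    obtain ⟨P, h, v, hv, hb, -⟩ := exists_poly_hom Q ![q]
    obtain ⟨b, rfl⟩ := hb b
    obtain ⟨b', rfl⟩ := hb b'
    have h₀ : h.map (v 0) = q := hv 0
    exact ⟨P, h, _, .add_right (v 0) b b', by rw [map_pairOf_add_right, h₀]⟩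
  | mul q q' b =>
    obtain ⟨P, h, v, hv, hb, -⟩ := exists_poly_hom Q ![q, q']
    obtain ⟨b, rfl⟩ := hb b
    have h₀ : h.map (v 0) = q := hv 0
    have h₁ : h.map (v 1) = q' := hv 1
    exact ⟨P, h, _, .mul (v 0) (v 1) b, by rw [map_pairOf_mul, h₀, h₁]⟩
  | str a b =>
    obtain ⟨P, h, -, -, hb, ha⟩ := exists_poly_hom Q ![]
    obtain ⟨b, rfl⟩ := hb b
    obtain ⟨a, rfl⟩ := ha a
    exact ⟨P, h, _, .str a b, by rw [map_pairOf_str]⟩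

variable (B) in
/-- The beginning of the resolution: pairs modulo relations. -/
noncomputable def derFreeMap : FreeMap B where
  tgt := pairShape B
  src := Shape.ofSubset (pairShape B).free fun P => {m | DerRel P.stage m}
  map := Shape.ofSubsetDesc _ _

variable {I : Cᵒᵖ ⥤ AddCommGrpCat.{u + 1}}

/-- The source of `derFreeMap` has generators only for relations at polynomial stages. These
suffice, since each relation involves at most two elements of the ring (`DerRel.exists_poly`). The
kernel is thus `Hom(B ⊗ Ω_X, I)`. -/
lemma homPresheafMap_derFreeMap_eq_zero_iff {X : Over B}
    (y : (homPresheaf I (pairShape B).free).obj (op X)) :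
    (homPresheafMap I (derFreeMap B).map).app (op X) y = 0 ↔
      ∀ V m, DerRel (atStage X V) m → homEv y V m = 0 := by
  refine ⟨fun h V m hm => ?_, fun h => Shape.homFree_ext fun V w => ?_⟩
  · obtain ⟨P, f, m', hm', rfl⟩ := hm.exists_poly
    obtain ⟨w, hw⟩ := Shape.exists_ofSubsetDesc_eq (M := (pairShape B).free)
      (R := fun P => {m | DerRel P.stage m}) f m' hm'
    refine (congrArg (homEv y V) hw).symm.trans ?_
    exact congr(homEv $h V (Shape.of _ w))
  · refine (homEv_homPresheafMap _ y V _).trans ?_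
    refine (congrArg (homEv y V) (Shape.ofSubsetDesc_of w)).trans ?_
    exact h _ _ (DerRel.map _ w.i.2.2)

end Relations

end TopAlg

/-! ### Derivations as homomorphisms -/

namespace TopAlg

variable {C : Type u} [SmallCategory C] {K : GrothendieckTopology C}
variable {A : Sheaf K CommRingCat.{u}} {B : Under A}

section Retract

variable {J : SheafOfModules.{u} (ringOf B)} {I : Cᵒᵖ ⥤ AddCommGrpCat.{u}}
  (ι : J.val.presheaf ⟶ I)

/-- The pairing `(x, b) ↦ ι (b · dx)` of a derivation `d`, on sections. -/
noncomputable def derVal {X : Over B} (d : Der J X) (V : Cᵒᵖ) (x : Sec X V)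
    (b : B.right.obj.obj V) : I.obj V := modEv ι V (b • Der.ev d V x)

section DerVal

variable {X : Over B} (d : Der J X)

lemma derVal_res {U V : Cᵒᵖ} (g : U ⟶ V) (x : Sec X U) (b : B.right.obj.obj U) :
    derVal ι d V (res X g x) (bres B g b) = I.map g (derVal ι d U x b) := by
  refine Eq.trans ?_ (modEv_res ι g (b • Der.ev d U x))
  rw [Der.mres_smul, ← Der.ev_map]
  rfl

lemma derVal_add (V : Cᵒᵖ) (x x' : Sec X V) (b : B.right.obj.obj V) :
    derVal ι d V (x + x') b = derVal ι d V x b + derVal ι d V x' b := by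
  simp only [derVal, map_add, smul_add]

lemma derVal_add_right (V : Cᵒᵖ) (x : Sec X V) (b b' : B.right.obj.obj V) :
    derVal ι d V x (b + b') = derVal ι d V x b + derVal ι d V x b' := by
  simp only [derVal, map_add, add_smul]

lemma derVal_mul (V : Cᵒᵖ) (x x' : Sec X V) (b : B.right.obj.obj V) :
    derVal ι d V (x * x') b = derVal ι d V x' (b * augMap X V x) +
      derVal ι d V x (b * augMap X V x') := by
  simp only [derVal, Der.ev_mul, smul_add, map_add, smul_smul]

lemma derVal_structMap (V : Cᵒᵖ) (a : A.obj.obj V) (b : B.right.obj.obj V) :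
    derVal ι d V (structMap X V a) b = 0 := by
  simp only [derVal, Der.ev_structMap, smul_zero, map_zero]

/-- The pairing of a derivation on decorated tuples. -/
noncomputable def derElVal (V : Cᵒᵖ) (w : Shape.El (pairShape B) (atStage X V)) :
    (I ⋙ AddCommGrpCat.uliftFunctor.{u + 1, u}).obj V :=
  ULift.up (derVal ι d V (w.q (0 : Fin 1)) w.ν.down.2)

lemma derElVal_map {U V : Cᵒᵖ} (g : U ⟶ V) (w : Shape.El (pairShape B) (atStage X U)) :
    derElVal ι d V (w.map (atRes X g)) =
      (I ⋙ AddCommGrpCat.uliftFunctor.{u + 1, u}).map g (derElVal ι d U w) :=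
  ULift.ext _ _ (derVal_res ι d g (w.q (0 : Fin 1)) w.ν.down.2)

/-- The pairing of a derivation. -/
noncomputable def derToHom :
    (homPresheaf (I ⋙ AddCommGrpCat.uliftFunctor.{u + 1, u}) (pairShape B).free).obj (op X) :=
  Shape.homFree (derElVal ι d) (derElVal_map ι d)

lemma homEv_derToHom (V : Cᵒᵖ) (x : Sec X V) (b : B.right.obj.obj V) :
    homEv (derToHom ι d) V (pairOf (Q := atStage X V) x b) = ULift.up (derVal ι d V x b) :=
  Shape.homEv_homFree (derElVal ι d) (derElVal_map ι d) V (pairEl (Q := atStage X V) x b)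

lemma homEv_derToHom_eq_zero (V : Cᵒᵖ) (m : (pairShape B).free.obj (atStage X V))
    (hm : DerRel (atStage X V) m) : homEv (derToHom ι d) V m = 0 := by
  have key : ∀ (x y z : Sec X V) (b b' b'' : B.right.obj.obj V),
      derVal ι d V x b = derVal ι d V y b' + derVal ι d V z b'' →
      homEv (derToHom ι d) V (pairOf (Q := atStage X V) x b - pairOf (Q := atStage X V) y b' -
        pairOf (Q := atStage X V) z b'') = 0 := fun x y z b b' b'' h => by
    rw [map_sub, map_sub, sub_sub, sub_eq_zero]
    refine (homEv_derToHom ι d V x b).trans ?_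
    refine Eq.trans (ULift.ext _ _ h) ?_
    exact congr($((homEv_derToHom ι d V y b').symm) + $((homEv_derToHom ι d V z b'').symm))
  cases hm with
  | add q q' b => exact key _ _ _ _ _ _ (derVal_add ι d V q q' b)
  | add_right q b b' => exact key _ _ _ _ _ _ (derVal_add_right ι d V q b b')
  | mul q q' b => exact key _ _ _ _ _ _ (derVal_mul ι d V q q' b)
  | str a b =>
    exact (homEv_derToHom ι d V (structMap X V a) b).trans
      (ULift.ext _ _ (derVal_structMap ι d V a b))

end DerVal

lemma homFree_ext_pairOf {I : Cᵒᵖ ⥤ AddCommGrpCat.{u + 1}} {X : Over B}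
    {y z : (homPresheaf I (pairShape B).free).obj (op X)}
    (h : ∀ V (x : Sec X V) b, homEv y V (pairOf (Q := atStage X V) x b) =
      homEv z V (pairOf (Q := atStage X V) x b)) : y = z :=
  Shape.homFree_ext fun V w => by
    rw [eq_pairEl w]
    exact h V _ _

/-! ### From pairings back to derivations -/

section Back

variable {X : Over B}
  (y : (homPresheaf (I ⋙ AddCommGrpCat.uliftFunctor.{u + 1, u}) (pairShape B).free).obj (op X))

/-- The values of a pairing of an algebra with `B`. -/
noncomputable def pairVal (V : Cᵒᵖ) (x : Sec X V) (b : B.right.obj.obj V) : I.obj V :=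
  ULift.down (homEv y V (pairOf (Q := atStage X V) x b))

lemma pairVal_res {U V : Cᵒᵖ} (g : U ⟶ V) (x : Sec X U) (b : B.right.obj.obj U) :
    pairVal y V (res X g x) (bres B g b) = I.map g (pairVal y U x b) := by
  refine congrArg ULift.down (Eq.trans ?_ (homEv_res y g (pairOf (Q := atStage X U) x b)))
  exact congrArg (homEv y V) (pairOf_map (atRes X g) x b).symm

variable (hy : ∀ V m, DerRel (atStage X V) m → homEv y V m = 0)

lemma pairVal_add (hy : ∀ V m, DerRel (atStage X V) m → homEv y V m = 0) (V : Cᵒᵖ)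
    (x x' : Sec X V) (b : B.right.obj.obj V) :
    pairVal y V (x + x') b = pairVal y V x b + pairVal y V x' b := by
  have := hy V _ (.add x x' b)
  rw [map_sub, map_sub, sub_sub, sub_eq_zero] at this
  exact congrArg ULift.down this

lemma pairVal_add_right (hy : ∀ V m, DerRel (atStage X V) m → homEv y V m = 0) (V : Cᵒᵖ)
    (x : Sec X V) (b b' : B.right.obj.obj V) :
    pairVal y V x (b + b') = pairVal y V x b + pairVal y V x b' := by
  have := hy V _ (.add_right x b b')
  rw [map_sub, map_sub, sub_sub, sub_eq_zero] at this
  exact congrArg ULift.down this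

lemma pairVal_mul (hy : ∀ V m, DerRel (atStage X V) m → homEv y V m = 0) (V : Cᵒᵖ)
    (x x' : Sec X V) (b : B.right.obj.obj V) :
    pairVal y V (x * x') b = pairVal y V x' (b * augMap X V x) +
      pairVal y V x (b * augMap X V x') := by
  have := hy V _ (.mul x x' b)
  rw [map_sub, map_sub, sub_sub, sub_eq_zero] at this
  exact congrArg ULift.down this

lemma pairVal_structMap (hy : ∀ V m, DerRel (atStage X V) m → homEv y V m = 0) (V : Cᵒᵖ)
    (a : A.obj.obj V) (b : B.right.obj.obj V) : pairVal y V (structMap X V a) b = 0 :=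
  congrArg ULift.down (hy V _ (DerRel.str (Q := atStage X V) a b))

/-- The section of the coinduced module given by a pairing. -/
noncomputable def pairCoind (U : Cᵒᵖ) : Sec X U →+ Coind B I U :=
  AddMonoidHom.mk' (fun x => ⟨fun V g => AddMonoidHom.mk' (pairVal y V (res X g x))
    (pairVal_add_right y hy V _), fun V W g h b => by
      refine Eq.trans ?_ (pairVal_res y h (res X g x) b)
      exact congrArg (fun x => pairVal y W x (bres B h b)) (res_comp X g h x)⟩)
    fun x x' => Coind.ext' fun V g b => by
      change pairVal y V (res X g (x + x')) b = pairVal y V (res X g x) b +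
        pairVal y V (res X g x') b
      rw [map_add, pairVal_add y hy]

variable (r : ∀ U, Coind B I U →+ Der.Mod J U)
  (hr : ∀ U (b : B.right.obj.obj U) (k : Coind B I U), r U (b • k) = b • r U k)
  (hr' : ∀ {U V : Cᵒᵖ} (g : U ⟶ V) (k : Coind B I U), r V (Coind.res g k) = Der.mres J g (r U k))

/-- The derivation given by a pairing and a retraction from the coinduced module. -/
noncomputable def homToDer : Der J X :=
  Der.mk' (fun U => (r U).comp (pairCoind y hy U))
    (fun U x x' => by
      change r U (pairCoind y hy U (x * x')) = augMap X U x • r U (pairCoind y hy U x') +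
        augMap X U x' • r U (pairCoind y hy U x)
      rw [← hr, ← hr, ← map_add]
      refine congrArg (r U) (Coind.ext' fun V g b => ?_)
      refine (congrArg (fun x => pairVal y V x b) (map_mul (res X g) x x')).trans ?_
      refine (pairVal_mul y hy V _ _ b).trans ?_
      rw [augMap_res, augMap_res, mul_comm b, mul_comm b]
      rfl)
    (fun {U V} g x => by
      change r V (pairCoind y hy V (res X g x)) = Der.mres J g (r U (pairCoind y hy U x))
      rw [← hr']
      refine congrArg (r V) (Coind.ext' fun W h b => ?_)
      exact congrArg (fun x => pairVal y W x b) (res_comp X g h x).symm)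
    (fun U a => by
      change r U (pairCoind y hy U (structMap X U a)) = 0
      rw [← map_zero (r U)]
      refine congrArg (r U) (Coind.ext' fun V g b => ?_)
      refine (congrArg (fun x => pairVal y V x b) (structMap_res X g a).symm).trans ?_
      exact pairVal_structMap y hy V _ b)

/-- The pairing of `d` gives the derivation `toCoindApp ι ∘ d` into the coinduced module, and `r`
undoes the embedding. Only this composite is an identity: derivations are a retract of pairings. -/
lemma homToDer_derToHom (hrι : ∀ U (j : Der.Mod J U), r U (toCoindApp ι U j) = j) (d : Der J X) :
    homToDer (derToHom ι d) (homEv_derToHom_eq_zero ι d) r hr hr' = d := by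
  ext U x
  refine Eq.trans ?_ (hrι U (Der.ev d U x))
  refine congrArg (r U) (Coind.ext' fun V g b => ?_)
  refine (congrArg ULift.down (homEv_derToHom ι d V (res X g x) b)).trans ?_
  rw [toCoindApp_apply, ← Der.ev_map]
  rfl

end Back

end Retract

end TopAlg

/-! ### Vanishing of cohomology -/

namespace TopAlg

variable {C : Type u} [SmallCategory C] {K : GrothendieckTopology C}
variable {A : Sheaf K CommRingCat.{u}} {B : Under A}

section Vanishing

variable {J : SheafOfModules.{u} (ringOf B)} {I : Sheaf K AddCommGrpCat.{u}}
  (ι : J.val.presheaf ⟶ I.obj)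

lemma derVal_add_der {X : Over B} (d d' : Der J X) (V : Cᵒᵖ) (x : Sec X V)
    (b : B.right.obj.obj V) :
    derVal ι (d + d') V x b = derVal ι d V x b + derVal ι d' V x b := by
  simp only [derVal, Der.ev_add, smul_add, map_add]

/-- The pairing of a derivation, as a morphism of presheaves. -/
noncomputable def derToHomPresheaf : derPresheaf J ⟶
    homPresheaf (I.obj ⋙ AddCommGrpCat.uliftFunctor.{u + 1, u}) (pairShape B).free where
  app X := AddCommGrpCat.ofHom (AddMonoidHom.mk' (fun d : ULift (Der J X.unop) =>
    derToHom ι d.down) fun d d' => homFree_ext_pairOf (X := X.unop) fun V x b => by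
      refine (homEv_derToHom (X := X.unop) ι (d + d').down V x b).trans ?_
      refine Eq.trans ?_ congr($((homEv_derToHom (X := X.unop) ι d.down V x b).symm) +
        $((homEv_derToHom (X := X.unop) ι d'.down V x b).symm))
      refine ULift.ext _ _ ?_
      exact derVal_add_der (X := X.unop) ι d.down d'.down V x b)
  naturality X Y f := AddCommGrpCat.hom_ext (AddMonoidHom.ext fun d : ULift (Der J X.unop) =>
    homFree_ext_pairOf (X := Y.unop) fun V x b => by
      refine (homEv_derToHom (X := Y.unop) ι (Der.precomp f.unop d.down) V x b).trans ?_
      refine (homEv_derToHom (X := X.unop) ι d.down V (secMap f.unop V x) b).symm.trans ?_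
      refine Eq.trans ?_ (homEv_map f.unop (derToHom ι d.down) V
        (pairOf (Q := atStage Y.unop V) x b)).symm
      refine congrArg (homEv (derToHom ι d.down) V) ?_
      refine Eq.trans ?_ (pairOf_map (atMap f.unop V) x b).symm
      exact congrArg (pairOf (Q := atStage X.unop V) _) (bres_id V b).symm)

lemma pairVal_map {I : Cᵒᵖ ⥤ AddCommGrpCat.{u}} {X Y : Over B} (f : Y ⟶ X)
    (y : (homPresheaf (I ⋙ AddCommGrpCat.uliftFunctor.{u + 1, u}) (pairShape B).free).obj (op X))
    (V : Cᵒᵖ) (x : Sec Y V) (b : B.right.obj.obj V) :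
    pairVal ((homPresheaf _ _).map f.op y) V x b = pairVal y V (secMap f V x) b := by
  refine congrArg ULift.down ((homEv_map f y V (pairOf (Q := atStage Y V) x b)).trans
    (congrArg (homEv y V) ?_))
  refine (pairOf_map (atMap f V) x b).trans ?_
  exact congrArg (pairOf (Q := atStage X V) _) (bres_id V b)

variable {τ : GrothendieckTopology (Over B)}

/-- `Der(-, J)` is a retract, through `i₀` and `ρ`, of the kernel of a morphism of injective sheaves
whose higher cohomology vanishes. -/
lemma subsingleton_H_derPresheaf [Injective J] (hτ : τ ≤ liftTopology B)
    (hτ' : uniformLiftTopology B ≤ τ) {T : Over B} (hT : IsTerminal T) (hT' : LocallyIndPoly T)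
    (h : Presheaf.IsSheaf τ (derPresheaf J)) (p : ℕ) :
    Subsingleton (Sheaf.H.{u + 1} (⟨derPresheaf J, h⟩ : Sheaf τ AddCommGrpCat.{u + 1}) (p + 1)) := by
  let F₀ : Sheaf K AddCommGrpCat.{u} := ⟨J.val.presheaf, J.isSheaf⟩
  let I : Sheaf K AddCommGrpCat.{u} := Injective.under F₀
  let ι : J.val.presheaf ⟶ I.obj := (Injective.ι F₀).hom
  have hι : ∀ U, Function.Injective (modEv ι U) := fun U => by
    have : Mono ((sheafToPresheaf K AddCommGrpCat.{u} ⋙ (evaluation _ _).obj U).map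
      (Injective.ι F₀)) := inferInstance
    exact (AddCommGrpCat.mono_iff_injective _).1 this
  obtain ⟨r, hr, hr', hrι⟩ := exists_coind_retraction ι hι
  have : Injective (I.obj ⋙ AddCommGrpCat.uliftFunctor.{u + 1, u}) :=
    injective_comp_uliftFunctor I.obj
  have hI := isSheaf_comp_uliftFunctor I
  let d := FreeMap.homSheafMap (derFreeMap B) hτ hI
  let i₀ : (⟨derPresheaf J, h⟩ : Sheaf τ AddCommGrpCat.{u + 1}) ⟶
    FreeMap.homSheaf hτ hI (derFreeMap B).tgt := ⟨derToHomPresheaf ι⟩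
  have hi₀ : i₀ ≫ d = 0 := by
    apply Sheaf.hom_ext
    ext X x
    exact (homPresheafMap_derFreeMap_eq_zero_iff (X := X.unop) _).2
      (homEv_derToHom_eq_zero (X := X.unop) ι x.down)
  have hker : ∀ (X : Over B) (y : (kernel d).obj.obj (op X)) (V) (m),
      DerRel (atStage X V) m → homEv ((kernel.ι d).hom.app (op X) y) V m = 0 := fun X y =>
    (homPresheafMap_derFreeMap_eq_zero_iff _).1
      congr(($(kernel.condition d)).hom.app (op X) y)
  -- Sections of the kernel are derivations into the coinduced module; `ρ` composes them with the
  -- retraction `r`.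
  let ρ : kernel d ⟶ (⟨derPresheaf J, h⟩ : Sheaf τ AddCommGrpCat.{u + 1}) :=
    ⟨{ app X := AddCommGrpCat.ofHom (AddMonoidHom.mk' (fun y =>
          ULift.up (homToDer (X := X.unop) _ (hker X.unop y) r hr hr'))
          (fun y z => ULift.ext _ _ (Der.ext' fun U x => by
            refine Eq.trans ?_ (map_add (r U) _ _)
            refine congrArg (r U) (Coind.ext' fun V g b => ?_)
            exact congrArg (fun e => pairVal (X := X.unop) e V (res X.unop g x) b)
              (map_add ((kernel.ι d).hom.app X).hom y z))))
       naturality X Y f := AddCommGrpCat.hom_ext (AddMonoidHom.ext fun y =>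
          ULift.ext _ _ (Der.ext' fun U x => by
            refine congrArg (r U) (Coind.ext' fun V g b => ?_)
            refine (congrArg (fun e => pairVal (X := Y.unop) e V (res Y.unop g x) b)
              congr($((kernel.ι d).hom.naturality f) y)).trans ?_
            refine (pairVal_map (X := X.unop) f.unop _ V _ b).trans ?_
            exact congrArg (fun x => pairVal (X := X.unop) _ V x b) (secMap_res f.unop g x))) }⟩
  have hρ : kernel.lift d i₀ hi₀ ≫ ρ = 𝟙 _ := by
    apply Sheaf.hom_ext
    ext X x
    refine ULift.ext _ _ ?_
    refine Eq.trans (Der.ext' fun U a => ?_)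
      (homToDer_derToHom (X := X.unop) ι r hr hr' hrι x.down)
    refine congrArg (r U) (Coind.ext' fun V g b => ?_)
    exact congrArg (fun e => pairVal (X := X.unop) e V (res X.unop g a) b)
      congr(($(kernel.lift_ι d i₀ hi₀)).hom.app X x)
  have := FreeMap.subsingleton_H_kernel_homSheafMap (derFreeMap B) hτ hI hτ' hT hT' p
  exact subsingleton_H_of_mono_split _ ρ hρ (p + 1)

end Vanishing

end TopAlg

theorem theoremA9 {C : Type u} [SmallCategory C] {K : GrothendieckTopology C}
    (A : Sheaf K CommRingCat.{u}) (S : Sheaf K (Type u))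
    (J : SheafOfModules.{u} (TopAlg.ringOf (TopAlg.freeAlg A S))) [Injective J]
    (p : ℕ) (hp : p ≠ 0) :
    Subsingleton (Sheaf.H.{u + 1} (TopAlg.derSheaf J) p) ∧
      Subsingleton (Sheaf.H.{u + 1} (TopAlg.derSheafUniform J) p) := by
  obtain ⟨p, rfl⟩ := Nat.exists_eq_succ_of_ne_zero hp
  -- Freeness of the base algebra enters only here: the terminal object has to be locally
  -- ind-polynomial, so that the resolution is exact on global sections.
  have hT : TopAlg.LocallyIndPoly (Over.mk (𝟙 (TopAlg.freeAlg A S))) :=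
    TopAlg.locallyIndPoly_freeAlgOn (S := S.obj) _
  exact ⟨TopAlg.subsingleton_H_derPresheaf le_rfl TopAlg.uniformLiftTopology_le Over.mkIdTerminal
    hT _ p, TopAlg.subsingleton_H_derPresheaf TopAlg.uniformLiftTopology_le le_rfl
      Over.mkIdTerminal hT _ p⟩
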